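/- **Setting.** Let $\mathbb K=\mathbb Q(q,t)$ and let $*$ be the automorphism of $\mathbb K$ fixing $q$ with $t\mapsto t^{-1}$. Draw a partition $\mu$ in the French way, with boxes $(r,c)$ in row $r$ and column $c$ counted from $0$; the weight of $(r,c)$ is $q^rt^c$, and boxes are identified with their weights. Let $\mathrm{arm}_\mu(\square)$, $\mathrm{leg}_\mu(\square)$ be the numbers of boxes of $\mu$ to the right of, resp. above, $\square$; let $A(\mu)$ be the set of boxes that can be added to $\mu$, let $\mu+x$ be $\mu$ with $x\in A(\mu)$ added, let $n(\mu)=\sum_i(i-1)\mu_i$, and let $\mu'$ be the transpose. For $k\ge 0$ let $F_k$ be the set of pairs $(\mu,w)$ where $\mu$ is a partition and $w=(w_1,\dots,w_k)$ are boxes of $\mu$ in distinct columns such that removing $w_1,w_2,\dots$ successively leaves a partition at each step. These index the torus-fixed points $I_{\mu,w}$ of the parabolic flag Hilbert schemes $\mathrm{PFH}_{|\mu|,|\mu|-k}$. Let $V_k$ be the $\mathbb K$-vector space with basis $[I_{\mu,w}]$, $(\mu,w)\in F_k$ (set $[I_{\mu,w}]=0$ if $(\mu,w)\notin F_k$), and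 put $H_{\mu,w}=(-1)^{|\mu|}q^{n(\mu)}t^{n(\mu')}[I_{\mu,w}]$. Define $\mathsf d_+:V_k\to V_{k+1}$, $\mathsf d_-:V_{k+1}\to V_k$, and invertible $\mathsf T_1,\dots,\mathsf T_k:V_{k+1}\to V_{k+1}$ by $$\mathsf d_+[I_{\mu,w}]=-t^k\sum_{x\in A(\mu)}x\,d_{\mu+x,\mu}\prod_{i=1}^k\frac{x-qw_i}{x-qtw_i}\,[I_{\mu+x,xw}],\qquad \mathsf d_-[I_{\mu,wx}]=[I_{\mu,w}],$$ $$\mathsf T_i[I_{\mu,w}]=\frac{(t-1)w_{i+1}}{w_i-w_{i+1}}[I_{\mu,w}]+\frac{w_i-tw_{i+1}}{w_i-w_{i+1}}[I_{\mu,s_i(w)}],$$ $$d_{\mu+x,\mu}=\prod_{\square\in R}\frac{t^{\mathrm{arm}_\mu(\square)}-q^{\mathrm{leg}_\mu(\square)+1}}{t^{\mathrm{arm}_\mu(\square)+1}-q^{\mathrm{leg}_\mu(\square)+1}}\prod_{\square\in C}\frac{t^{\mathrm{arm}_\mu(\square)+1}-q^{\mathrm{leg}_\mu(\square)}}{t^{\mathrm{arm}_\mu(\square)+1}-q^{\mathrm{leg}_\mu(\square)+1}},$$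 where $R$, $C$ are the sets of boxes of $\mu$ in the row, resp. column, of $x$. **Indexing.** For $(\xi,w)\in F_k$ and $n>|\xi|$, put $m=n-k$ and $\phi(\xi,w)=(\lambda|\gamma)$, where $\gamma_i$ is the row of $w_i$ and $\lambda=(\lambda_1\ge\dots\ge\lambda_m)$ lists the heights of the columns of $\xi$ containing no $w_i$, padded by zeros. **Pieri coefficients.** For a composition $\nu=(\nu_1,\dots,\nu_n)$, $1\le i\le n$ and $\square=(i,j)$ (position $i$, height $1\le j\le\nu_i$), let $\ell_\nu(\square)=\nu_i-j$ and $$a_\nu(\square)=\#\{r<i: j\le\nu_r\le\nu_i\}+\#\{r>i:j-1\le\nu_r<\nu_i\},\quad \widetilde a_\nu(\square)=\#\{r<i: j\le\nu_r\le\nu_i\}+\#\{r>i:j\le\nu_r<\nu_i\},$$ $$\overline\nu_i=q^{\nu_i}t^{-l'_\nu(i)},\qquad l'_\nu(i)=\#\{j<i:\nu_j>\nu_i\}+\#\{j>i:\nu_j\ge\nu_i\}.$$ Given $(\lambda|\gamma)$ as above, choose an entry $L$ of $\lambda$ and a set $I=\{t_1<\dots<t_r\}\subseteq\{1,\dots,k\}$,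 $r\ge0$, with $t_0=0$, $t_{r+1}=k+1$, $\gamma_{t_0}:=L$. Let $\eta_i=\gamma_i$ for $i\notin I$ and $\eta_{t_j}=\gamma_{t_{j-1}}$ for $1\le j\le r$. Let $\widetilde\mu\in(\mathbb Z_{\ge0})^m$ be obtained from $\lambda$ by replacing one entry $L$ by $\gamma_{t_r}+1$ and rearranging so that all entries equal to $\gamma_{t_r}+1$ are at the right end, the first of them in position $h$, and the others are weakly increasing; let $\widetilde\lambda=(\widetilde\mu_1,\dots,\widetilde\mu_{m-1},L)$, and let $\mu$ be the weakly decreasing rearrangement of $\widetilde\mu$. Call $I$ maximal if $\eta_j\ne\eta_{t_u}$ for $1\le u\le r$, $t_{u-1}<j<t_u$, and $\eta_j\ne\gamma_{t_r}$ for $t_r<j\le k$. If $(\mu|\eta)$ arises in this way from $(\lambda|\gamma)$ by an $L$ and a maximal $I$, put $$\mathcal A^{(\lambda|\gamma)}_{(\mu|\eta)}=\prod_{\substack{\square=(i,L+1)\\ i\le m,\ \lambda^-_i\ge L+1}}\frac{t-q^{\ell(\square)+1}t^{a(\square)+1}}{1-q^{\ell(\square)+1}t^{a(\square)+1}}\cdot\prod_{j=1}^{L}\frac{1-q^{\ell(i_0,j)}t^{\widetilde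 a(i_0,j)+1}}{1-q^{\ell(i_0,j)+1}t^{\widetilde a(i_0,j)+1+m_{j-1}(\gamma)}}\cdot p'_I\cdot\frac{q^{-\widetilde\mu_h+1}}{1-t}\cdot\overline{(\widetilde\lambda|\gamma)}_m ,$$ where $\lambda^-$ is the increasing rearrangement of $\lambda$, arms and legs are taken in $(\lambda^-|\gamma)$, $i_0$ is the largest $i\le m$ with $\lambda^-_i=L$, $m_{j-1}(\gamma)=\#\{i:\gamma_i=j-1\}$, and, with $\overline\eta_j=\overline{(\widetilde\mu|\eta)}_{m+j}$ and $z=q^{-1}\,\overline{(\widetilde\mu|\eta)}_h$, $$p'_I=\frac{(t-1)z}{z-\overline\eta_{t_r}}\prod_{u=1}^{r-1}\frac{(t-1)\overline\eta_{t_{u+1}}}{\overline\eta_{t_{u+1}}-\overline\eta_{t_u}}\prod_{j=t_r+1}^k\frac{tz-\overline\eta_j}{z-\overline\eta_j}\prod_{u=1}^r\prod_{j=t_{u-1}+1}^{t_u-1}\frac{t\overline\eta_{t_u}-\overline\eta_j}{\overline\eta_{t_u}-\overline\eta_j},$$ the first factor being omitted if $r=0$. (This is the coefficient of $\mathcal J_{(\mu|\eta)}$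 in Goodberry's Pieri formula for $e_1(X)\mathcal J_{(\lambda|\gamma)}$.) Otherwise put $\mathcal A^{(\lambda|\gamma)}_{(\mu|\eta)}=0$. **Theorem 6.4.** Let $(\xi,w)\in F_k$. For $x\in A(\xi)$ and $I=\{t_1<\dots<t_r\}\subseteq\{1,\dots,k\}$ let $v=s_k\cdots\widehat s_{t_r}\cdots\widehat s_{t_1}\cdots s_1$ (the $s_i$ with $i\in I$ omitted), acting on tuples by permuting positions, and let $(v(xw))'$ be $v(x,w_1,\dots,w_k)$ with its last entry removed. Then $$\left(\mathsf d_-\mathsf T_k^{-1}\cdots\mathsf T_1^{-1}\mathsf d_+\right)H_{\xi,w}=\sum_{x,v}C^{\xi,w}_{\xi+x,(v(xw))'}\,H_{\xi+x,(v(xw))'},$$ the sum being over all such $x$ and $v$ with $(\xi+x,(v(xw))')\in F_k$, where $C^{\xi,w}_{\xi+x,(v(xw))'}$ is the coefficient of $H_{\xi+x,(v(xw))'}$ in the expansion of the left side in the basis $(H_{\mu,u})_{(\mu,u)\in F_k}$. For every $n>|\xi|$ and every such $x,v$, $$C^{\xi,w}_{\xi+x,(v(xw))'}=t^{-c_r}\left[\mathcal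 A^{(\lambda|\gamma)}_{(\mu|\eta)}\cdot(1-t)\right]^*,$$ where $(\lambda|\gamma)=\phi(\xi,w)$, $(\mu|\eta)=\phi(\xi+x,(v(xw))')$, and $c_r$ is the column index of $w_{t_r}$ (of $x$ if $r=0$). -/

import Mathlib

/-! Torus fixed points of parabolic flag Hilbert schemes, the operators of the Carlsson-Mellit
algebra on them, and the degree one Pieri coefficients of partially symmetric integral form
Macdonald polynomials.

A box is a pair `(r, c)`, with `r` its row and `c` its column, both counted from `0`; French
pictures, so that row `r` of the diagram of a partition `μ` has `μ_{r+1}` boxes.  A `YoungDiagram`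
of Mathlib is read in this way. -/

open Finset

namespace PFH

/-- The field `ℚ(q,t) = ℚ(q)(t)`. -/
abbrev K : Type := RatFunc (RatFunc ℚ)

noncomputable def q : K := RatFunc.C RatFunc.X

noncomputable def t : K := RatFunc.X

theorem t_ne_zero : t ≠ 0 := RatFunc.X_ne_zero

theorem q_ne_zero : q ≠ 0 := by
  unfold q
  simp [RatFunc.X_ne_zero]

theorem aeval_t_inv_injective :
    Function.Injective (Polynomial.aeval (R := RatFunc ℚ) (t⁻¹ : K)) := by
  rw [← transcendental_iff_injective]
  intro h
  exact RatFunc.transcendental_X (IsAlgebraic.inv_iff.1 h)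

/-- The substitution `t ↦ t⁻¹`, fixing `q`, as an endomorphism. -/
noncomputable def starHom : K →ₐ[RatFunc ℚ] K :=
  RatFunc.liftAlgHom (Polynomial.aeval (R := RatFunc ℚ) (t⁻¹ : K))
    (nonZeroDivisors_le_comap_nonZeroDivisors_of_injective _ aeval_t_inv_injective)

theorem starHom_t : starHom t = t⁻¹ := by
  have h := RatFunc.liftAlgHom_apply_div _
    (nonZeroDivisors_le_comap_nonZeroDivisors_of_injective _ aeval_t_inv_injective)
    (Polynomial.X : Polynomial (RatFunc ℚ)) 1
  simp only [RatFunc.algebraMap_X, map_one, div_one, Polynomial.aeval_X] at h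
  exact h

theorem starHom_starHom (f : K) : starHom (starHom f) = f := by
  have h : ∀ p : Polynomial (RatFunc ℚ),
      starHom (starHom (algebraMap _ K p)) = algebraMap _ K p := by
    intro p
    induction p using Polynomial.induction_on' with
    | add p r hp hr => simp only [map_add, hp, hr]
    | monomial n a =>
      have hC : starHom (RatFunc.C a) = RatFunc.C a := starHom.commutes a
      rw [← Polynomial.C_mul_X_pow_eq_monomial]
      have hX : starHom (RatFunc.X) = t⁻¹ := starHom_t
      simp only [map_mul, map_pow, RatFunc.algebraMap_C, RatFunc.algebraMap_X, hC, hX, map_inv₀,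
        starHom_t, inv_inv]
      rfl
  induction f using RatFunc.induction_on with
  | f p r hr => rw [map_div₀, map_div₀, h, h]

/-- The automorphism `*` of `ℚ(q,t)` that fixes `q` and sends `t` to `t⁻¹`. -/
noncomputable def star : K ≃ₐ[RatFunc ℚ] K :=
  AlgEquiv.ofAlgHom starHom starHom (AlgHom.ext starHom_starHom) (AlgHom.ext starHom_starHom)

theorem star_t : star t = t⁻¹ := starHom_t

theorem star_q : star q = q := star.commutes RatFunc.X

/-- The torus weight `q^r t^c` of the box in row `r` and column `c`. -/
noncomputable def wt (b : ℕ × ℕ) : K := q ^ b.1 * t ^ b.2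

theorem wt_ne_zero (b : ℕ × ℕ) : wt b ≠ 0 :=
  mul_ne_zero (pow_ne_zero _ q_ne_zero) (pow_ne_zero _ t_ne_zero)

theorem wt_ne_wt {a b : ℕ × ℕ} (h : a.2 ≠ b.2) : wt a ≠ wt b := by
  have hd : ∀ c : ℕ × ℕ, (wt c).intDegree = c.2 := by
    intro c
    have hpow : ∀ n : ℕ, (t ^ n : K).intDegree = n := by
      intro n
      induction n with
      | zero => simp
      | succ n ih =>
        rw [pow_succ, RatFunc.intDegree_mul (pow_ne_zero _ t_ne_zero) t_ne_zero, ih]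
        simp [t]
    have hq : (q ^ c.1 : K).intDegree = 0 := by
      rw [q, ← map_pow, RatFunc.intDegree_C]
    rw [wt, RatFunc.intDegree_mul (pow_ne_zero _ q_ne_zero) (pow_ne_zero _ t_ne_zero), hq, hpow,
      zero_add]
  intro hab
  have h1 := hd a
  rw [hab, hd b] at h1
  exact h (by exact_mod_cast h1.symm)

/-! ### Diagrams -/

/-- Number of boxes to the right of `b` in its row. -/
def arm (μ : YoungDiagram) (b : ℕ × ℕ) : ℕ := μ.rowLen b.1 - (b.2 + 1)

/-- Number of boxes above `b` in its column. -/
def leg (μ : YoungDiagram) (b : ℕ × ℕ) : ℕ := μ.colLen b.2 - (b.1 + 1)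

/-- `n(μ) = ∑ i, (i - 1) μ_i`. -/
def nStat (μ : YoungDiagram) : ℕ := ∑ r ∈ range (μ.colLen 0), r * μ.rowLen r

/-- The boxes that can be added to `μ`. -/
noncomputable def addable (μ : YoungDiagram) : Finset (ℕ × ℕ) :=
  open Classical in
  ((range (μ.colLen 0 + 1)).image fun r => (r, μ.rowLen r)).filter
    fun x => IsLowerSet (insert x (μ.cells : Set (ℕ × ℕ)))

theorem mem_addable {μ : YoungDiagram} {x : ℕ × ℕ} :
    x ∈ addable μ ↔ x ∉ μ ∧ IsLowerSet (insert x (μ.cells : Set (ℕ × ℕ))) := by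
  obtain ⟨r, c⟩ := x
  simp only [addable, mem_filter, mem_image, mem_range, Prod.mk.injEq]
  constructor
  · rintro ⟨⟨r', -, rfl, rfl⟩, h⟩
    exact ⟨fun h' => lt_irrefl _ (YoungDiagram.mem_iff_lt_rowLen.1 h'), h⟩
  · rintro ⟨h1, h2⟩
    refine ⟨⟨r, ?_, rfl, ?_⟩, h2⟩
    · by_contra hr
      have hm : (r - 1, 0) ∈ insert (r, c) (μ.cells : Set (ℕ × ℕ)) :=
        h2 (Prod.mk_le_mk.2 ⟨Nat.sub_le _ _, Nat.zero_le _⟩) (Set.mem_insert _ _)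
      rcases hm with hm | hm
      · simp only [Prod.mk.injEq] at hm
        omega
      · have := YoungDiagram.mem_iff_lt_colLen.1 (show (r - 1, 0) ∈ μ from hm)
        omega
    · rw [YoungDiagram.mem_iff_lt_rowLen] at h1
      by_contra hc
      have hm : (r, c - 1) ∈ insert (r, c) (μ.cells : Set (ℕ × ℕ)) :=
        h2 (Prod.mk_le_mk.2 ⟨le_rfl, Nat.sub_le _ _⟩) (Set.mem_insert _ _)
      rcases hm with hm | hm
      · simp only [Prod.mk.injEq] at hm
        omega
      · have := YoungDiagram.mem_iff_lt_rowLen.1 (show (r, c - 1) ∈ μ from hm)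
        omega

/-- The smallest diagram containing `μ` and `x`; if `x` is addable this is `μ` with `x` added. -/
def addBox (μ : YoungDiagram) (x : ℕ × ℕ) : YoungDiagram where
  cells := μ.cells ∪ Iic x
  isLowerSet := by
    rw [coe_union, coe_Iic]
    exact μ.isLowerSet.union (isLowerSet_Iic x)

theorem addBox_cells {μ : YoungDiagram} {x : ℕ × ℕ} (hx : x ∈ addable μ) :
    (addBox μ x).cells = insert x μ.cells := by
  have h := (mem_addable.1 hx).2
  ext b
  simp only [addBox, mem_union, mem_Iic, mem_insert]
  constructor
  · rintro (hb | hb)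
    · exact Or.inr hb
    · exact h hb (Set.mem_insert _ _)
  · rintro (rfl | hb)
    · exact Or.inr le_rfl
    · exact Or.inl hb

/-! ### Fixed points -/

/-- The pairs `(μ, w)` that index torus fixed points: `w = (w_1, …, w_k)` lists boxes of `μ`, no two
of them in one column, such that removing `w_1, w_2, …` from `μ` in this order leaves a
partition after each step. -/
structure IsFlag {k : ℕ} (μ : YoungDiagram) (w : Fin k → ℕ × ℕ) : Prop where
  mem : ∀ i, w i ∈ μ
  col_injective : Function.Injective fun i => (w i).2
  chain : ∀ s : ℕ, IsLowerSet {b : ℕ × ℕ | b ∈ μ ∧ ∀ i : Fin k, i.1 < s → b ≠ w i}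

/-- The torus fixed points `I_{μ,w}` of all `PFH_{n,n-k}`, `n ≥ k`, for a given `k`; here
`n = |μ|`. -/
@[ext] structure FixedPoint (k : ℕ) where
  shape : YoungDiagram
  box : Fin k → ℕ × ℕ
  isFlag : IsFlag shape box

/-- The direct sum over `n ≥ k` of the localized equivariant `K`-groups of `PFH_{n,n-k}`, with its
basis of fixed point classes. -/
abbrev V (k : ℕ) : Type := FixedPoint k →₀ K

/-- The class `[I_{μ,w}]`; zero if `(μ, w)` does not index a fixed point. -/
noncomputable def cls {k : ℕ} (μ : YoungDiagram) (w : Fin k → ℕ × ℕ) : V k :=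
  open Classical in if h : IsFlag μ w then Finsupp.single ⟨μ, w, h⟩ 1 else 0

theorem cls_self {k : ℕ} (P : FixedPoint k) : cls P.shape P.box = Finsupp.single P 1 := by
  simp [cls, P.isFlag]

/-- The scalar `(-1)^{|μ|} q^{n(μ)} t^{n(μ')}`. -/
noncomputable def normFactor (μ : YoungDiagram) : K :=
  (-1) ^ μ.card * q ^ nStat μ * t ^ nStat μ.transpose

theorem isUnit_normFactor (μ : YoungDiagram) : IsUnit (normFactor μ) :=
  (mul_ne_zero (mul_ne_zero (pow_ne_zero _ (by norm_num)) (pow_ne_zero _ q_ne_zero))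
    (pow_ne_zero _ t_ne_zero)).isUnit

/-- The basis `H_{μ,w} = (-1)^{|μ|} q^{n(μ)} t^{n(μ')} [I_{μ,w}]`. -/
noncomputable def H (k : ℕ) : Module.Basis (FixedPoint k) K (V k) :=
  Finsupp.basisSingleOne.isUnitSMul fun P => isUnit_normFactor P.shape

theorem H_apply {k : ℕ} (P : FixedPoint k) :
    H k P = normFactor P.shape • (Finsupp.single P 1 : V k) := by
  simp [H, Module.Basis.isUnitSMul_apply]

/-! ### Operators -/

/-- The Macdonald-Pieri coefficient `d_{μ+x,μ}`. -/
noncomputable def macPieri (μ : YoungDiagram) (x : ℕ × ℕ) : K :=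
  (∏ b ∈ μ.cells with b.1 = x.1,
      (t ^ arm μ b - q ^ (leg μ b + 1)) / (t ^ (arm μ b + 1) - q ^ (leg μ b + 1))) *
    ∏ b ∈ μ.cells with b.2 = x.2,
      (t ^ (arm μ b + 1) - q ^ leg μ b) / (t ^ (arm μ b + 1) - q ^ (leg μ b + 1))

/-- The tuple `x w = (x, w_1, …, w_k)`. -/
def consBox {k : ℕ} (x : ℕ × ℕ) (w : Fin k → ℕ × ℕ) : Fin (k + 1) → ℕ × ℕ :=
  Fin.cons (α := fun _ => ℕ × ℕ) x w

/-- The tuple with its last entry removed. -/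
def dropLast {k : ℕ} (w : Fin (k + 1) → ℕ × ℕ) : Fin k → ℕ × ℕ := fun i => w i.castSucc

/-- `d_+`, raising `k` by one. -/
noncomputable def dPlus (k : ℕ) : V k →ₗ[K] V (k + 1) :=
  Finsupp.linearCombination K fun P =>
    -t ^ k • ∑ x ∈ addable P.shape,
      (wt x * macPieri P.shape x *
        ∏ i, (wt x - q * wt (P.box i)) / (wt x - q * t * wt (P.box i))) •
          cls (addBox P.shape x) (consBox x P.box)

/-- `d_-`, lowering `k` by one: `[I_{μ,wx}] ↦ [I_{μ,w}]`. -/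
noncomputable def dMinus (k : ℕ) : V (k + 1) →ₗ[K] V k :=
  Finsupp.linearCombination K fun P => cls P.shape (dropLast P.box)

theorem isFlag_dropLast {k : ℕ} {μ : YoungDiagram} {w : Fin (k + 1) → ℕ × ℕ} (h : IsFlag μ w) :
    IsFlag μ (dropLast w) := by
  refine ⟨fun i => h.mem _, fun i j hij => Fin.castSucc_injective _ (h.col_injective hij),
    fun s => ?_⟩
  convert h.chain (min s k) using 1
  ext b
  simp only [Set.mem_ofPred_eq, dropLast, and_congr_right_iff]
  intro _
  constructor
  · intro hb i hi
    have := hb ⟨i.1, by omega⟩ (by simp only; omega)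
    simpa using this
  · intro hb i hi
    exact hb i.castSucc (by simp only [Fin.val_castSucc]; omega)

/-- The simple transposition `s_i`, for `i : Fin k` exchanging the positions `i` and `i + 1` among
`0, …, k`. -/
def simpleSwap {k : ℕ} (i : Fin k) : Equiv.Perm (Fin (k + 1)) := Equiv.swap i.castSucc i.succ

/-- The operator `T_i` on fixed point classes. -/
noncomputable def heckeT {k : ℕ} (i : Fin k) : V (k + 1) →ₗ[K] V (k + 1) :=
  Finsupp.linearCombination K fun P =>
    ((t - 1) * wt (P.box i.succ) / (wt (P.box i.castSucc) - wt (P.box i.succ))) •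
        cls P.shape P.box +
      ((wt (P.box i.castSucc) - t * wt (P.box i.succ)) /
          (wt (P.box i.castSucc) - wt (P.box i.succ))) •
        cls P.shape (P.box ∘ simpleSwap i)

/-- The explicit formula for the inverse of `T_i`. -/
noncomputable def heckeTInv {k : ℕ} (i : Fin k) : V (k + 1) →ₗ[K] V (k + 1) :=
  Finsupp.linearCombination K fun P =>
    ((1 - t⁻¹) * wt (P.box i.castSucc) / (wt (P.box i.castSucc) - wt (P.box i.succ))) •
        cls P.shape P.box +
      ((t⁻¹ * wt (P.box i.castSucc) - wt (P.box i.succ)) /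
          (wt (P.box i.castSucc) - wt (P.box i.succ))) •
        cls P.shape (P.box ∘ simpleSwap i)

/-- If exchanging two consecutive boxes of a flag does not give a flag, the boxes are adjacent. -/
theorem wt_of_not_isFlag {k : ℕ} (P : FixedPoint (k + 1)) (i : Fin k)
    (h : ¬ IsFlag P.shape (P.box ∘ simpleSwap i)) :
    wt (P.box i.castSucc) = t * wt (P.box i.succ) := by
  set a := P.box i.castSucc with ha
  set b := P.box i.succ with hb
  have hne : a.2 ≠ b.2 := fun hab => by
    have := P.isFlag.col_injective hab
    simp [Fin.ext_iff] at this
  -- the boxes other than `a`, `b` that remain after the first `i` removals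
  have hbox : ∀ j : Fin (k + 1), j ≠ i.castSucc → j ≠ i.succ →
      P.box (simpleSwap i j) = P.box j := fun j h1 h2 => by
    rw [simpleSwap, Equiv.swap_apply_of_ne_of_ne h1 h2]
  have hboxl : P.box (simpleSwap i i.castSucc) = b := by
    rw [simpleSwap, Equiv.swap_apply_left]
  have hboxr : P.box (simpleSwap i i.succ) = a := by
    rw [simpleSwap, Equiv.swap_apply_right]
  have hset : ∀ s : ℕ, s ≠ i.1 + 1 →
      {c : ℕ × ℕ | c ∈ P.shape ∧ ∀ j : Fin (k + 1), j.1 < s → c ≠ (P.box ∘ simpleSwap i) j} =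
        {c : ℕ × ℕ | c ∈ P.shape ∧ ∀ j : Fin (k + 1), j.1 < s → c ≠ P.box j} := by
    intro s hs
    ext c
    simp only [Set.mem_ofPred_eq, Function.comp, and_congr_right_iff]
    intro _
    constructor
    · intro hc j hj
      by_cases h1 : j = i.castSucc
      · subst h1
        simp only [Fin.val_castSucc] at hj
        have := hc i.succ (by simp only [Fin.val_succ]; omega)
        rwa [hboxr] at this
      by_cases h2 : j = i.succ
      · subst h2
        simp only [Fin.val_succ] at hj
        have := hc i.castSucc (by simp only [Fin.val_castSucc]; omega)
        rwa [hboxl] at this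
      have := hc j hj
      rwa [hbox j h1 h2] at this
    · intro hc j hj
      by_cases h1 : j = i.castSucc
      · subst h1
        simp only [Fin.val_castSucc] at hj
        rw [hboxl]
        exact hc i.succ (by simp only [Fin.val_succ]; omega)
      by_cases h2 : j = i.succ
      · subst h2
        simp only [Fin.val_succ] at hj
        rw [hboxr]
        exact hc i.castSucc (by simp only [Fin.val_castSucc]; omega)
      rw [hbox j h1 h2]
      exact hc j hj
  have hnl : ¬ IsLowerSet {c : ℕ × ℕ | c ∈ P.shape ∧
      ∀ j : Fin (k + 1), j.1 < i.1 + 1 → c ≠ (P.box ∘ simpleSwap i) j} := by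
    intro hl
    refine h ⟨fun j => P.isFlag.mem _, fun j l hjl =>
      (simpleSwap i).injective (P.isFlag.col_injective hjl), fun s => ?_⟩
    by_cases hs : s = i.1 + 1
    · rw [hs]
      exact hl
    · rw [hset s hs]
      exact P.isFlag.chain s
  have c1 := P.isFlag.chain (i.1 + 1)
  have c2 := P.isFlag.chain (i.1 + 2)
  have c0 := P.isFlag.chain i.1
  -- membership in the set with `b` removed first
  have hmem : ∀ c : ℕ × ℕ, c ∈ {c : ℕ × ℕ | c ∈ P.shape ∧
      ∀ j : Fin (k + 1), j.1 < i.1 + 1 → c ≠ (P.box ∘ simpleSwap i) j} ↔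
        c ∈ {c : ℕ × ℕ | c ∈ P.shape ∧ ∀ j : Fin (k + 1), j.1 < i.1 → c ≠ P.box j} ∧ c ≠ b := by
    intro c
    simp only [Set.mem_ofPred_eq, Function.comp]
    constructor
    · rintro ⟨h0, hc⟩
      refine ⟨⟨h0, fun j hj => ?_⟩, ?_⟩
      · have := hc j (by omega)
        rwa [hbox j (fun e => by subst e; simp at hj) (fun e => by subst e; simp at hj)] at this
      · have := hc i.castSucc (by simp)
        rwa [hboxl] at this
    · rintro ⟨⟨h0, hc⟩, hcb⟩
      refine ⟨h0, fun j hj => ?_⟩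
      by_cases h1 : j = i.castSucc
      · subst h1
        rwa [hboxl]
      · have h3 : j.1 ≠ i.1 := fun e => h1 (Fin.ext (by simpa using e))
        rw [hbox j h1 (fun e => by subst e; simp at hj)]
        exact hc j (by omega)
  have hmem1 : ∀ c : ℕ × ℕ, c ∈ {c : ℕ × ℕ | c ∈ P.shape ∧
      ∀ j : Fin (k + 1), j.1 < i.1 + 1 → c ≠ P.box j} ↔
        c ∈ {c : ℕ × ℕ | c ∈ P.shape ∧ ∀ j : Fin (k + 1), j.1 < i.1 → c ≠ P.box j} ∧ c ≠ a := by
    intro c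
    simp only [Set.mem_ofPred_eq]
    constructor
    · rintro ⟨h0, hc⟩
      exact ⟨⟨h0, fun j hj => hc j (by omega)⟩, hc i.castSucc (by simp)⟩
    · rintro ⟨⟨h0, hc⟩, hcb⟩
      refine ⟨h0, fun j hj => ?_⟩
      by_cases h1 : j = i.castSucc
      · subst h1
        exact hcb
      · have h3 : j.1 ≠ i.1 := fun e => h1 (Fin.ext (by simpa using e))
        exact hc j (by omega)
  have hmem2 : ∀ c : ℕ × ℕ, c ∈ {c : ℕ × ℕ | c ∈ P.shape ∧
      ∀ j : Fin (k + 1), j.1 < i.1 + 2 → c ≠ P.box j} ↔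
        c ∈ {c : ℕ × ℕ | c ∈ P.shape ∧ ∀ j : Fin (k + 1), j.1 < i.1 + 1 → c ≠ P.box j} ∧
          c ≠ b := by
    intro c
    simp only [Set.mem_ofPred_eq]
    constructor
    · rintro ⟨h0, hc⟩
      exact ⟨⟨h0, fun j hj => hc j (by omega)⟩, hc i.succ (by simp)⟩
    · rintro ⟨⟨h0, hc⟩, hcb⟩
      refine ⟨h0, fun j hj => ?_⟩
      by_cases h1 : j = i.succ
      · subst h1
        exact hcb
      · have h3 : j.1 ≠ i.1 + 1 := fun e => h1 (Fin.ext (by simpa using e))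
        exact hc j (by omega)
  generalize {c : ℕ × ℕ | c ∈ P.shape ∧
      ∀ j : Fin (k + 1), j.1 < i.1 + 1 → c ≠ (P.box ∘ simpleSwap i) j} = S' at hnl hmem
  generalize {c : ℕ × ℕ | c ∈ P.shape ∧
      ∀ j : Fin (k + 1), j.1 < i.1 + 2 → c ≠ P.box j} = S2 at c2 hmem2
  generalize {c : ℕ × ℕ | c ∈ P.shape ∧
      ∀ j : Fin (k + 1), j.1 < i.1 + 1 → c ≠ P.box j} = S1 at c1 hmem1 hmem2
  generalize {c : ℕ × ℕ | c ∈ P.shape ∧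
      ∀ j : Fin (k + 1), j.1 < i.1 → c ≠ P.box j} = S0 at c0 hmem hmem1
  -- some box of `S'` lies above `b`; it must be `a`
  have hab : b ≤ a ∧ a ∈ S0 := by
    by_contra hcon
    apply hnl
    intro c d hdc hc
    rw [hmem] at hc ⊢
    refine ⟨c0 hdc hc.1, ?_⟩
    rintro rfl
    by_cases hca : c = a
    · subst hca
      exact hcon ⟨hdc, hc.1⟩
    · have : c ∈ S2 := by
        rw [hmem2, hmem1]
        exact ⟨⟨hc.1, hca⟩, hc.2⟩
      exact ((hmem2 _).1 (c2 hdc this)).2 rfl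
  obtain ⟨hle, haS⟩ := hab
  have hbetween : ∀ c : ℕ × ℕ, b ≤ c → c ≤ a → c = a ∨ c = b := by
    intro c h1 h2
    by_contra hcon
    rw [not_or] at hcon
    have : c ∈ S2 := by
      rw [hmem2, hmem1]
      exact ⟨⟨c0 h2 haS, hcon.1⟩, hcon.2⟩
    exact ((hmem2 _).1 (c2 h1 this)).2 rfl
  have hlt : b.2 < a.2 := lt_of_le_of_ne hle.2 (Ne.symm hne)
  have hb1 := hbetween (b.1, b.2 + 1) ⟨le_rfl, Nat.le_succ _⟩ ⟨hle.1, hlt⟩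
  have hba : (b.1, b.2 + 1) = a := by
    rcases hb1 with h1 | h1
    · exact h1
    · have := congrArg Prod.snd h1
      simp at this
  rw [← hba]
  simp only [wt, pow_succ]
  ring

theorem wt_sub_ne_zero {k : ℕ} (P : FixedPoint (k + 1)) (i : Fin k) :
    wt (P.box i.castSucc) - wt (P.box i.succ) ≠ 0 := by
  refine sub_ne_zero.2 (wt_ne_wt fun hab => ?_)
  have := P.isFlag.col_injective hab
  simp [Fin.ext_iff] at this

theorem heckeT_cls {k : ℕ} (i : Fin k) (P : FixedPoint (k + 1)) :
    heckeT i (cls P.shape P.box) =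
      ((t - 1) * wt (P.box i.succ) / (wt (P.box i.castSucc) - wt (P.box i.succ))) •
          cls P.shape P.box +
        ((wt (P.box i.castSucc) - t * wt (P.box i.succ)) /
            (wt (P.box i.castSucc) - wt (P.box i.succ))) •
          cls P.shape (P.box ∘ simpleSwap i) := by
  conv_lhs => rw [cls_self, heckeT, Finsupp.linearCombination_single, one_smul]

theorem heckeTInv_cls {k : ℕ} (i : Fin k) (P : FixedPoint (k + 1)) :
    heckeTInv i (cls P.shape P.box) =
      ((1 - t⁻¹) * wt (P.box i.castSucc) / (wt (P.box i.castSucc) - wt (P.box i.succ))) •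
          cls P.shape P.box +
        ((t⁻¹ * wt (P.box i.castSucc) - wt (P.box i.succ)) /
            (wt (P.box i.castSucc) - wt (P.box i.succ))) •
          cls P.shape (P.box ∘ simpleSwap i) := by
  conv_lhs => rw [cls_self, heckeTInv, Finsupp.linearCombination_single, one_smul]

theorem comp_simpleSwap {k : ℕ} (i : Fin k) (w : Fin (k + 1) → ℕ × ℕ) :
    (w ∘ simpleSwap i) ∘ simpleSwap i = w := by
  funext j
  simp [simpleSwap]

theorem smul_combination {M : Type} [AddCommGroup M] [Module K M] {a b c d e f : K} {x y : M}
    (h1 : a * b + d * f = 1) (h2 : a * c + d * e = 0) :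
    a • (b • x + c • y) + d • (e • y + f • x) = x := by
  have h : a • (b • x + c • y) + d • (e • y + f • x) =
      (a * b + d * f) • x + (a * c + d * e) • y := by
    simp only [smul_add, smul_smul, add_smul]
    abel
  rw [h, h1, h2, one_smul, zero_smul, add_zero]

theorem heckeT_heckeTInv {k : ℕ} (i : Fin k) : heckeT i ∘ₗ heckeTInv i = LinearMap.id := by
  refine Finsupp.lhom_ext' fun P => LinearMap.ext_ring ?_
  simp only [LinearMap.comp_apply, Finsupp.lsingle_apply, LinearMap.id_apply]
  rw [← cls_self, heckeTInv_cls, map_add, map_smul, map_smul, heckeT_cls]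
  have hab := wt_sub_ne_zero P i
  have ht := t_ne_zero
  by_cases h : IsFlag P.shape (P.box ∘ simpleSwap i)
  · have hQ := heckeT_cls i ⟨P.shape, P.box ∘ simpleSwap i, h⟩
    simp only [comp_simpleSwap] at hQ
    have e1 : (P.box ∘ simpleSwap i) i.castSucc = P.box i.succ := by simp [simpleSwap]
    have e2 : (P.box ∘ simpleSwap i) i.succ = P.box i.castSucc := by simp [simpleSwap]
    rw [e1, e2] at hQ
    rw [hQ]
    generalize wt (P.box i.castSucc) = a at *
    generalize wt (P.box i.succ) = b at *
    have hba : b - a ≠ 0 := fun e => hab (by linear_combination -e)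
    apply smul_combination
    · field_simp
      ring
    · field_simp
      ring
  · have h0 : cls P.shape (P.box ∘ simpleSwap i) = 0 := by simp [cls, h]
    have hw := wt_of_not_isFlag P i h
    rw [h0]
    rw [hw] at hab ⊢
    generalize wt (P.box i.succ) = b at *
    have hb : b ≠ 0 := fun e => hab (by rw [e]; ring)
    have ht1 : t - 1 ≠ 0 := fun e => hab (by linear_combination b * e)
    have hab' : t * b - b = (t - 1) * b := by ring
    rw [hab']
    simp only [smul_zero, add_zero, map_zero, smul_smul]
    convert one_smul K _ using 2
    field_simp

theorem heckeTInv_heckeT {k : ℕ} (i : Fin k) : heckeTInv i ∘ₗ heckeT i = LinearMap.id := by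
  refine Finsupp.lhom_ext' fun P => LinearMap.ext_ring ?_
  simp only [LinearMap.comp_apply, Finsupp.lsingle_apply, LinearMap.id_apply]
  rw [← cls_self, heckeT_cls, map_add, map_smul, map_smul, heckeTInv_cls]
  have hab := wt_sub_ne_zero P i
  have ht := t_ne_zero
  by_cases h : IsFlag P.shape (P.box ∘ simpleSwap i)
  · have hQ := heckeTInv_cls i ⟨P.shape, P.box ∘ simpleSwap i, h⟩
    simp only [comp_simpleSwap] at hQ
    have e1 : (P.box ∘ simpleSwap i) i.castSucc = P.box i.succ := by simp [simpleSwap]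
    have e2 : (P.box ∘ simpleSwap i) i.succ = P.box i.castSucc := by simp [simpleSwap]
    rw [e1, e2] at hQ
    rw [hQ]
    generalize wt (P.box i.castSucc) = a at *
    generalize wt (P.box i.succ) = b at *
    have hba : b - a ≠ 0 := fun e => hab (by linear_combination -e)
    apply smul_combination
    · field_simp
      ring
    · field_simp
      ring
  · have h0 : cls P.shape (P.box ∘ simpleSwap i) = 0 := by simp [cls, h]
    have hw := wt_of_not_isFlag P i h
    rw [h0]
    rw [hw] at hab ⊢
    generalize wt (P.box i.succ) = b at *
    have hb : b ≠ 0 := fun e => hab (by rw [e]; ring)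
    have ht1 : t - 1 ≠ 0 := fun e => hab (by linear_combination b * e)
    have hab' : t * b - b = (t - 1) * b := by ring
    rw [hab']
    simp only [smul_zero, add_zero, map_zero, smul_smul]
    convert one_smul K _ using 2
    field_simp

/-- `T_i` as an invertible operator. -/
noncomputable def heckeEquiv {k : ℕ} (i : Fin k) : V (k + 1) ≃ₗ[K] V (k + 1) :=
  LinearEquiv.ofLinearMap (heckeT i) (heckeTInv i) (heckeT_heckeTInv i) (heckeTInv_heckeT i)

/-- `d_- T_k⁻¹ ⋯ T_1⁻¹ d_+`. -/
noncomputable def eOne (k : ℕ) : V k →ₗ[K] V k :=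
  dMinus k ∘ₗ
    (List.ofFn fun i : Fin k => ((heckeEquiv i).symm : Module.End K (V (k + 1)))).reverse.prod ∘ₗ
      dPlus k

/-- The coefficient of `H_Q` in `(d_- T_k⁻¹ ⋯ T_1⁻¹ d_+) H_P`. -/
noncomputable def geomCoeff {k : ℕ} (P Q : FixedPoint k) : K := (H k).repr (eOne k (H k P)) Q

/-- The permutation `v = s_k ⋯ s_1` with the factors `s_i`, `i ∈ I`, omitted. -/
def vPerm {k : ℕ} (I : Finset (Fin k)) : Equiv.Perm (Fin (k + 1)) :=
  (List.ofFn fun i : Fin k => if i ∈ I then 1 else simpleSwap i).reverse.prod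

/-- The tuple `(v(xw))'`: permute `(x, w_1, …, w_k)` by `v` and remove the last entry. -/
def movedBoxes {k : ℕ} (x : ℕ × ℕ) (w : Fin k → ℕ × ℕ) (I : Finset (Fin k)) : Fin k → ℕ × ℕ :=
  dropLast (consBox x w ∘ ⇑(vPerm I)⁻¹)

/-- The entry `w_{t_r}` for the largest element `t_r` of `I`; it is `x` if `I` is empty. -/
def lastBox {k : ℕ} (x : ℕ × ℕ) (w : Fin k → ℕ × ℕ) (I : Finset (Fin k)) : ℕ × ℕ :=
  if h : I.Nonempty then w (I.max' h) else x

/-! ### The bijection with pairs `(λ|γ)` -/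

/-- `γ_i` is the row index of the `i`-th labeled box. -/
def gam {k : ℕ} (P : FixedPoint k) : Fin k → ℕ := fun i => (P.box i).1

/-- `λ`, with `m` entries: the heights of the first `m` columns containing no labeled box. -/
noncomputable def lam {k : ℕ} (P : FixedPoint k) (m : ℕ) : List ℕ :=
  (List.range m).map fun j => P.shape.colLen (Nat.nth (fun c => ∀ i, (P.box i).2 ≠ c) j)

/-! ### Compositions

A composition `ν` is a list; the column index `i` below is counted from `0`, the height `j` of a box
from `1`, so that `(i, j)` is a box if `i < ν.length` and `1 ≤ j ≤ ν_i`. -/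

/-- The entry `ν_i`. -/
def part (ν : List ℕ) (i : ℕ) : ℕ := ν.getD i 0

def legC (ν : List ℕ) (i j : ℕ) : ℕ := part ν i - j

/-- The arm `a_ν(i, j)`. -/
def armC (ν : List ℕ) (i j : ℕ) : ℕ :=
  #{r ∈ range i | j ≤ part ν r ∧ part ν r ≤ part ν i} +
    #{r ∈ Ioo i ν.length | j ≤ part ν r + 1 ∧ part ν r < part ν i}

/-- The arm `ã_ν(i, j)`. -/
def armT (ν : List ℕ) (i j : ℕ) : ℕ :=
  #{r ∈ range i | j ≤ part ν r ∧ part ν r ≤ part ν i} +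
    #{r ∈ Ioo i ν.length | j ≤ part ν r ∧ part ν r < part ν i}

/-- `l'_ν(i)`. -/
def coleg (ν : List ℕ) (i : ℕ) : ℕ :=
  #{j ∈ range i | part ν i < part ν j} + #{j ∈ Ioo i ν.length | part ν i ≤ part ν j}

/-- The eigenvalue `q^{ν_i} t^{-l'_ν(i)}`. -/
noncomputable def eig (ν : List ℕ) (i : ℕ) : K := q ^ part ν i * (t ^ coleg ν i)⁻¹

/-! ### Pieri coefficients -/

/-- `γ_{t_r}` for the largest element `t_r` of `I`, and `L` if `I` is empty. -/
def lastVal {k : ℕ} (γ : Fin k → ℕ) (L : ℕ) (I : Finset (Fin k)) : ℕ :=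
  if h : I.Nonempty then γ (I.max' h) else L

/-- The composition `η`: for `I = {t_1 < ⋯ < t_r}`, the entry in position `t_j` is `γ_{t_{j-1}}`, where
`γ_{t_0} = L`, and the other entries are those of `γ`. -/
def etaOf {k : ℕ} (γ : Fin k → ℕ) (L : ℕ) (I : Finset (Fin k)) : Fin k → ℕ := fun i =>
  if i ∈ I then lastVal γ L {j ∈ I | j < i} else γ i

/-- `μ̃`: the entries of `λ` with one entry `L` removed and one entry `top = γ_{t_r} + 1` inserted,
arranged with all entries equal to `top` at the right end and the others weakly increasing. -/
def muTilde {k : ℕ} (lam : List ℕ) (γ : Fin k → ℕ) (L : ℕ) (I : Finset (Fin k)) : List ℕ :=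
  ((lam.erase L).filter fun a => a ≠ lastVal γ L I + 1).insertionSort (· ≤ ·) ++
    List.replicate ((lam.erase L).count (lastVal γ L I + 1) + 1) (lastVal γ L I + 1)

/-- `λ̃`: all but the last entry are those of `μ̃`, the last one is `L`. -/
def lamTilde {k : ℕ} (lam : List ℕ) (γ : Fin k → ℕ) (L : ℕ) (I : Finset (Fin k)) : List ℕ :=
  (muTilde lam γ L I).dropLast ++ [L]

/-- The positions after `t_r` (all positions if `I` is empty). -/
def tailGap {k : ℕ} (I : Finset (Fin k)) : Finset (Fin k) := {j | ∀ i ∈ I, i < j}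

/-- The positions strictly between `t_{u-1}` and `t_u = s`. -/
def gap {k : ℕ} (I : Finset (Fin k)) (s : Fin k) : Finset (Fin k) :=
  {j | j < s ∧ ∀ i ∈ I, i < s → i < j}

/-- `I` is maximal: no `η_j` strictly between `t_{u-1}` and `t_u` equals `η_{t_u}`, and no `η_j` after
`t_r` equals `μ̃_m - 1 = γ_{t_r}`. -/
def IsMaximal {k : ℕ} (γ : Fin k → ℕ) (L : ℕ) (I : Finset (Fin k)) : Prop :=
  (∀ s ∈ I, ∀ j ∈ gap I s, etaOf γ L I j ≠ etaOf γ L I s) ∧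
    ∀ j ∈ tailGap I, etaOf γ L I j ≠ lastVal γ L I

/-- `(μ|η)` lies in the support of the Pieri expansion for `(λ|γ)`, by the choice of the entry `L` of
`λ` and of the maximal set `I`. -/
def IsPieriDatum {k : ℕ} (lam : List ℕ) (γ : Fin k → ℕ) (mu : List ℕ) (η : Fin k → ℕ) (L : ℕ)
    (I : Finset (Fin k)) : Prop :=
  L ∈ lam ∧ η = etaOf γ L I ∧ IsMaximal γ L I ∧
    mu.Perm (muTilde lam γ L I) ∧ mu.Pairwise (· ≥ ·)

/-- The factor `p'_I`.  With `I` empty, only its third factor is present. -/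
noncomputable def pPrime {k : ℕ} (lam : List ℕ) (γ : Fin k → ℕ) (L : ℕ) (I : Finset (Fin k)) : K :=
  let ν := muTilde lam γ L I ++ List.ofFn (etaOf γ L I)
  let e : Fin k → K := fun j => eig ν (lam.length + j)
  let z : K := q⁻¹ * eig ν ((muTilde lam γ L I).idxOf (lastVal γ L I + 1))
  (if h : I.Nonempty then (t - 1) * z / (z - e (I.max' h)) else 1) *
    (∏ p ∈ I ×ˢ I with p.1 < p.2 ∧ ∀ i ∈ I, ¬ (p.1 < i ∧ i < p.2),
      (t - 1) * e p.2 / (e p.2 - e p.1)) *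
    (∏ j ∈ tailGap I, (t * z - e j) / (z - e j)) *
    ∏ s ∈ I, ∏ j ∈ gap I s, (t * e s - e j) / (e s - e j)

/-- The factor `j_C`, a product over the boxes of the rightmost column of height `L` in `λ⁻`. -/
noncomputable def jC {k : ℕ} (lam : List ℕ) (γ : Fin k → ℕ) (L : ℕ) : K :=
  let ν := lam.reverse ++ List.ofFn γ
  let c := {i ∈ range lam.length | part ν i = L}.sup id
  ∏ j ∈ Icc 1 L,
    (1 - q ^ legC ν c j * t ^ (armT ν c j + 1)) /
      (1 - q ^ (legC ν c j + 1) * t ^ (armT ν c j + 1 + #{i | γ i = j - 1}))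

/-- The product over the boxes at height `L + 1` in `λ⁻`. -/
noncomputable def rowFactor {k : ℕ} (lam : List ℕ) (γ : Fin k → ℕ) (L : ℕ) : K :=
  let ν := lam.reverse ++ List.ofFn γ
  ∏ i ∈ range lam.length with L + 1 ≤ part ν i,
    (t - q ^ (legC ν i (L + 1) + 1) * t ^ (armC ν i (L + 1) + 1)) /
      (1 - q ^ (legC ν i (L + 1) + 1) * t ^ (armC ν i (L + 1) + 1))

/-- The Pieri coefficient attached to the entry `L` of `λ` and the set `I`. -/
noncomputable def pieriTerm {k : ℕ} (lam : List ℕ) (γ : Fin k → ℕ) (L : ℕ) (I : Finset (Fin k)) :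
    K :=
  rowFactor lam γ L * jC lam γ L * pPrime lam γ L I * (1 / (1 - t)) *
    q ^ (-((lastVal γ L I + 1 : ℕ) : ℤ) + 1) *
    eig (lamTilde lam γ L I ++ List.ofFn γ) (lam.length - 1)

/-- The coefficient of `J_(μ|η)` in the Pieri rule for `e_1(X) J_(λ|γ)`; zero outside the support. -/
noncomputable def pieriCoeff {k : ℕ} (lam : List ℕ) (γ : Fin k → ℕ) (mu : List ℕ)
    (η : Fin k → ℕ) : K :=
  open Classical in
  if h : ∃ d : ℕ × Finset (Fin k), IsPieriDatum lam γ mu η d.1 d.2 then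
    pieriTerm lam γ h.choose.1 h.choose.2
  else 0

end PFH

namespace PFH

/-! ### The field -/

theorem q_pow_injective : Function.Injective fun n : ℕ => (q ^ n : K) := by
  intro a b hab
  simp only [q, ← map_pow] at hab
  have h1 : (RatFunc.X ^ a : RatFunc ℚ) = RatFunc.X ^ b := RatFunc.C_injective hab
  have hd : ∀ n : ℕ, (RatFunc.X ^ n : RatFunc ℚ).intDegree = n := by
    intro n
    induction n with
    | zero => simp
    | succ n ih =>
      rw [pow_succ, RatFunc.intDegree_mul (pow_ne_zero _ RatFunc.X_ne_zero) RatFunc.X_ne_zero, ih]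
      simp
  have h2 := hd a
  rw [h1, hd b] at h2
  exact_mod_cast h2.symm

theorem wt_injective : Function.Injective wt := by
  intro a b hab
  have h2 : a.2 = b.2 := by
    by_contra h
    exact wt_ne_wt h hab
  refine Prod.ext ?_ h2
  rw [wt, wt, h2] at hab
  exact q_pow_injective (mul_right_cancel₀ (pow_ne_zero _ t_ne_zero) hab)

theorem t_pow_ne_q_pow {a b : ℕ} (h : a ≠ 0 ∨ b ≠ 0) : (t ^ a : K) ≠ q ^ b := by
  intro e
  have : wt (0, a) = wt (b, 0) := by simpa [wt] using e
  have := wt_injective this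
  simp only [Prod.mk.injEq] at this
  omega

theorem t_pow_sub_q_pow_ne_zero {a b : ℕ} (h : a ≠ 0 ∨ b ≠ 0) : (t ^ a - q ^ b : K) ≠ 0 :=
  sub_ne_zero.2 (t_pow_ne_q_pow h)

theorem star_eig (ν : List ℕ) (i : ℕ) : star (eig ν i) = wt (part ν i, coleg ν i) := by
  simp [eig, wt, map_mul, map_pow, map_inv₀, star_t, star_q]

/-! ### Diagrams -/

theorem lt_rowLen_iff_lt_colLen {μ : YoungDiagram} {r c : ℕ} : c < μ.rowLen r ↔ r < μ.colLen c := by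
  rw [← YoungDiagram.mem_iff_lt_rowLen, ← YoungDiagram.mem_iff_lt_colLen]

theorem rowLen_le_card (μ : YoungDiagram) (r : ℕ) : μ.rowLen r ≤ μ.card := by
  rw [YoungDiagram.rowLen_eq_card]
  exact card_le_card (filter_subset _ _)

theorem snd_lt_card {μ : YoungDiagram} {b : ℕ × ℕ} (h : b ∈ μ) : b.2 < μ.card :=
  (YoungDiagram.mem_iff_lt_rowLen.1 h).trans_le (rowLen_le_card μ b.1)

theorem mem_addBox {μ : YoungDiagram} {x : ℕ × ℕ} (hx : x ∈ addable μ) {b : ℕ × ℕ} :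
    b ∈ addBox μ x ↔ b = x ∨ b ∈ μ := by
  rw [← YoungDiagram.mem_cells, addBox_cells hx, mem_insert, YoungDiagram.mem_cells]

theorem card_addBox {μ : YoungDiagram} {x : ℕ × ℕ} (hx : x ∈ addable μ) :
    (addBox μ x).card = μ.card + 1 := by
  rw [YoungDiagram.card, addBox_cells hx, card_insert_of_notMem]
  exact (mem_addable.1 hx).1

theorem addable_colLen {μ : YoungDiagram} {x : ℕ × ℕ} (hx : x ∈ addable μ) :
    μ.colLen x.2 = x.1 := by
  obtain ⟨h1, h2⟩ := mem_addable.1 hx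
  apply le_antisymm
  · exact not_lt.1 fun h => h1 (YoungDiagram.mem_iff_lt_colLen.2 h)
  · by_contra! h
    rcases h2 (show ((μ.colLen x.2, x.2) : ℕ × ℕ) ≤ x from ⟨h.le, le_rfl⟩)
      (Set.mem_insert _ _) with hm | hm
    · have := congrArg Prod.fst hm
      simp only at this
      omega
    · exact lt_irrefl _ (YoungDiagram.mem_iff_lt_colLen.1 hm)

theorem addable_rowLen {μ : YoungDiagram} {x : ℕ × ℕ} (hx : x ∈ addable μ) :
    μ.rowLen x.1 = x.2 := by
  obtain ⟨h1, h2⟩ := mem_addable.1 hx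
  apply le_antisymm
  · exact not_lt.1 fun h => h1 (YoungDiagram.mem_iff_lt_rowLen.2 h)
  · by_contra! h
    rcases h2 (show ((x.1, μ.rowLen x.1) : ℕ × ℕ) ≤ x from ⟨le_rfl, h.le⟩)
      (Set.mem_insert _ _) with hm | hm
    · have := congrArg Prod.snd hm
      simp only at this
      omega
    · exact lt_irrefl _ (YoungDiagram.mem_iff_lt_rowLen.1 hm)

theorem colLen_addBox_self {μ : YoungDiagram} {x : ℕ × ℕ} (hx : x ∈ addable μ) :
    (addBox μ x).colLen x.2 = x.1 + 1 := by
  apply le_antisymm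
  · by_contra! h
    rcases (mem_addBox hx).1 (YoungDiagram.mem_iff_lt_colLen.2 h) with hm | hm
    · have := congrArg Prod.fst hm
      simp at this
    · have := YoungDiagram.mem_iff_lt_colLen.1 hm
      rw [addable_colLen hx] at this
      omega
  · exact YoungDiagram.mem_iff_lt_colLen.1 ((mem_addBox hx).2 (Or.inl rfl))

theorem colLen_addBox_of_ne {μ : YoungDiagram} {x : ℕ × ℕ} (hx : x ∈ addable μ) {c : ℕ}
    (hc : c ≠ x.2) : (addBox μ x).colLen c = μ.colLen c := by
  refine eq_of_forall_lt_iff fun r => ?_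
  rw [← YoungDiagram.mem_iff_lt_colLen, ← YoungDiagram.mem_iff_lt_colLen, mem_addBox hx]
  refine or_iff_right fun h => hc ?_
  rw [← h]

/-! ### Flags -/

variable {k : ℕ} {μ : YoungDiagram} {w : Fin k → ℕ × ℕ}

theorem IsFlag.colLen (h : IsFlag μ w) (i : Fin k) : μ.colLen (w i).2 = (w i).1 + 1 := by
  have h1 : (w i).1 < μ.colLen (w i).2 := YoungDiagram.mem_iff_lt_colLen.1 (h.mem i)
  by_contra hne
  have hb : ((w i).1 + 1, (w i).2) ∈ μ := YoungDiagram.mem_iff_lt_colLen.2 (by omega)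
  have hl := h.chain (i.1 + 1) (show w i ≤ ((w i).1 + 1, (w i).2) from ⟨Nat.le_succ _, le_rfl⟩)
    ⟨hb, fun j _ e => ?_⟩
  · exact hl.2 i (Nat.lt_succ_self _) rfl
  · have hc := congrArg Prod.snd e
    have : i = j := h.col_injective hc
    subst this
    have hr := congrArg Prod.fst e
    simp at hr

theorem IsFlag.exists_of_lt (h : IsFlag μ w) {i : Fin k} {c : ℕ} (hc : (w i).2 < c)
    (hr : (w i).1 < μ.colLen c) : ∃ j < i, w j = ((w i).1, c) := by
  by_contra! hne
  have hl := h.chain (i.1 + 1) (show w i ≤ ((w i).1, c) from ⟨le_rfl, hc.le⟩)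
    ⟨YoungDiagram.mem_iff_lt_colLen.2 hr, fun j hj e => ?_⟩
  · exact hl.2 i (Nat.lt_succ_self _) rfl
  · rcases (Nat.lt_succ_iff.1 hj).lt_or_eq with hj | hj
    · exact hne j hj e.symm
    · rw [Fin.ext hj] at e
      have := congrArg Prod.snd e
      simp only at this
      omega

theorem IsFlag.snd_lt_of_lt (h : IsFlag μ w) {i j : Fin k} (hij : i < j)
    (hr : (w i).1 = (w j).1) : (w j).2 < (w i).2 := by
  by_contra! hle
  have hne : (w i).2 ≠ (w j).2 := fun e => hij.ne (h.col_injective e)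
  obtain ⟨l, hl, e⟩ := h.exists_of_lt (lt_of_le_of_ne hle hne) (by rw [h.colLen j]; omega)
  have e2 : (w l).2 = (w j).2 := by rw [e]
  have : l = j := h.col_injective e2
  omega

theorem IsFlag.lt_snd_of_free (h : IsFlag μ w) {i : Fin k} {c : ℕ} (hc : ∀ j, (w j).2 ≠ c)
    (hr : (w i).1 < μ.colLen c) : c < (w i).2 := by
  by_contra! hle
  obtain ⟨j, -, e⟩ := h.exists_of_lt (lt_of_le_of_ne hle (hc i)) hr
  exact hc j (congrArg Prod.snd e)

theorem IsFlag.free_lt_iff (h : IsFlag μ w) {i : Fin k} {c : ℕ} (hc : ∀ j, (w j).2 ≠ c) :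
    c < (w i).2 ↔ (w i).1 < μ.colLen c := by
  refine ⟨fun hlt => ?_, h.lt_snd_of_free hc⟩
  have := μ.colLen_anti c (w i).2 hlt.le
  rw [h.colLen] at this
  omega

theorem IsFlag.snd_lt_iff (h : IsFlag μ w) {i j : Fin k} :
    (w j).2 < (w i).2 ↔ (w i).1 < (w j).1 ∨ ((w i).1 = (w j).1 ∧ i < j) := by
  constructor
  · intro hlt
    have := μ.colLen_anti (w j).2 (w i).2 hlt.le
    rw [h.colLen, h.colLen] at this
    rcases (Nat.le_of_succ_le_succ this).lt_or_eq with h1 | h1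
    · exact Or.inl h1
    · refine Or.inr ⟨h1, ?_⟩
      by_contra! hji
      rcases hji.lt_or_eq with h2 | h2
      · have := h.snd_lt_of_lt h2 h1.symm
        omega
      · rw [h2] at hlt
        exact lt_irrefl _ hlt
  · rintro (h1 | ⟨h1, h2⟩)
    · by_contra! hle
      have := μ.colLen_anti _ _ hle
      rw [h.colLen, h.colLen] at this
      omega
    · exact h.snd_lt_of_lt h2 h1

theorem isFlag_consBox {x : ℕ × ℕ} (hx : x ∈ addable μ) (h : IsFlag μ w)
    (hc : ∀ i, (w i).2 ≠ x.2) : IsFlag (addBox μ x) (consBox x w) := by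
  refine ⟨fun i => ?_, fun i j => ?_, fun s => ?_⟩
  · rw [mem_addBox hx]
    induction i using Fin.cases with
    | zero => exact Or.inl rfl
    | succ i => exact Or.inr (h.mem i)
  · induction i using Fin.cases with
    | zero =>
      induction j using Fin.cases with
      | zero => exact fun _ => rfl
      | succ j => exact fun e => (hc j e.symm).elim
    | succ i =>
      induction j using Fin.cases with
      | zero => exact fun e => (hc i e).elim
      | succ j => exact fun e => congrArg Fin.succ (h.col_injective e)
  · rcases s with _ | s
    · exact fun a b hba ha =>
        ⟨(addBox μ x).isLowerSet hba ha.1, fun i hi => (Nat.not_lt_zero _ hi).elim⟩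
    · convert h.chain s using 1
      ext b
      simp only [Set.mem_ofPred_eq, mem_addBox hx, Fin.forall_fin_succ, consBox, Fin.cons_zero,
        Fin.cons_succ, Fin.val_succ, Fin.val_zero]
      constructor
      · rintro ⟨h1, h2, h3⟩
        exact ⟨h1.resolve_left (h2 (Nat.succ_pos _)), fun i hi => h3 i (by omega)⟩
      · rintro ⟨h1, h2⟩
        refine ⟨Or.inr h1, fun _ e => (mem_addable.1 hx).1 (e ▸ h1), fun i hi => h2 i (by omega)⟩

end PFH

namespace PFH

/-! ### The action of `T_k⁻¹ ⋯ T_1⁻¹` -/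

variable {k : ℕ}

/-- The tuple `x w` after the first `j` factors of `v` have acted. -/
def partialMove (x : ℕ × ℕ) (w : Fin k → ℕ × ℕ) (I : Finset (Fin k)) (j : ℕ) (i : Fin (k + 1)) :
    ℕ × ℕ :=
  if h : i.1 < j ∧ i.1 < k then
    if ⟨i.1, h.2⟩ ∈ I then lastBox x w {l ∈ I | l < ⟨i.1, h.2⟩} else w ⟨i.1, h.2⟩
  else if i.1 = j then lastBox x w {l ∈ I | l.1 < j} else consBox x w i

theorem lastBox_empty (x : ℕ × ℕ) (w : Fin k → ℕ × ℕ) : lastBox x w ∅ = x := by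
  simp [lastBox]

theorem lastBox_of_max {x : ℕ × ℕ} {w : Fin k → ℕ × ℕ} {I : Finset (Fin k)} {a : Fin k}
    (ha : a ∈ I) (hmax : ∀ i ∈ I, i ≤ a) : lastBox x w I = w a := by
  have h : I.Nonempty := ⟨a, ha⟩
  rw [lastBox, dif_pos h]
  congr 1
  exact le_antisymm (hmax _ (I.max'_mem h)) (I.le_max' _ ha)

theorem partialMove_zero (x : ℕ × ℕ) (w : Fin k → ℕ × ℕ) (I : Finset (Fin k)) :
    partialMove x w I 0 = consBox x w := by
  funext i
  rw [partialMove, dif_neg (by simp)]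
  split_ifs with h
  · have : i = 0 := Fin.ext h
    subst this
    simp [lastBox_empty, consBox]
  · rfl

theorem partialMove_castSucc (x : ℕ × ℕ) (w : Fin k → ℕ × ℕ) (I : Finset (Fin k)) (j : Fin k) :
    partialMove x w I j j.castSucc = lastBox x w {l ∈ I | l < j} := by
  rw [partialMove, dif_neg (by simp), if_pos (by simp)]
  rfl

theorem partialMove_succ (x : ℕ × ℕ) (w : Fin k → ℕ × ℕ) (I : Finset (Fin k)) (j : Fin k) :
    partialMove x w I j j.succ = w j := by
  rw [partialMove, dif_neg (by simp), if_neg (by simp), consBox, Fin.cons_succ]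

theorem partialMove_add_one (x : ℕ × ℕ) (w : Fin k → ℕ × ℕ) (I : Finset (Fin k)) (j : Fin k) :
    partialMove x w I (j.1 + 1) =
      if j ∈ I then partialMove x w I j else partialMove x w I j ∘ simpleSwap j := by
  have hmem : ∀ i : Fin (k + 1), i ≠ j.castSucc → i ≠ j.succ →
      partialMove x w I (j.1 + 1) i = partialMove x w I j i := by
    intro i h1 h2
    have h1' : i.1 ≠ j.1 := fun e => h1 (Fin.ext e)
    have h2' : i.1 ≠ j.1 + 1 := fun e => h2 (Fin.ext e)
    have h3 : i.1 < j.1 + 1 ∧ i.1 < k ↔ i.1 < j.1 ∧ i.1 < k := by omega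
    simp only [partialMove, h3, h1', h2', if_false]
  have hc : partialMove x w I (j.1 + 1) j.castSucc =
      if j ∈ I then lastBox x w {l ∈ I | l < j} else w j := by
    rw [partialMove, dif_pos (by simp)]
    rfl
  have hs : partialMove x w I (j.1 + 1) j.succ =
      if j ∈ I then w j else lastBox x w {l ∈ I | l < j} := by
    rw [partialMove, dif_neg (by simp), if_pos (by simp)]
    split_ifs with h
    · exact lastBox_of_max (by simp [h]) fun i hi => by
        have := (mem_filter.1 hi).2
        rw [Fin.le_def]
        omega
    · congr 1
      ext l
      simp only [mem_filter, and_congr_right_iff, Fin.lt_def]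
      intro hl
      have : l.1 ≠ j.1 := fun e => h (Fin.ext e ▸ hl)
      omega
  funext i
  by_cases h1 : i = j.castSucc
  · subst h1
    rw [hc]
    split_ifs with h
    · rw [partialMove_castSucc]
    · rw [Function.comp, simpleSwap, Equiv.swap_apply_left, partialMove_succ]
  by_cases h2 : i = j.succ
  · subst h2
    rw [hs]
    split_ifs with h
    · rw [partialMove_succ]
    · rw [Function.comp, simpleSwap, Equiv.swap_apply_right, partialMove_castSucc]
  rw [hmem i h1 h2]
  split_ifs with h
  · rfl
  · rw [Function.comp, simpleSwap, Equiv.swap_apply_of_ne_of_ne h1 h2]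

theorem take_ofFn_succ_reverse_prod {M : Type*} [Monoid M] (f : Fin k → M) (j : Fin k) :
    ((List.ofFn f).take (j.1 + 1)).reverse.prod = f j * ((List.ofFn f).take j.1).reverse.prod := by
  rw [List.take_succ_eq_append_getElem (by simp)]
  simp

theorem partialMove_eq_comp (x : ℕ × ℕ) (w : Fin k → ℕ × ℕ) (I : Finset (Fin k)) :
    ∀ j ≤ k, partialMove x w I j = consBox x w ∘
      ⇑((((List.ofFn fun i : Fin k => if i ∈ I then 1 else simpleSwap i).take j).reverse.prod :
        Equiv.Perm (Fin (k + 1)))⁻¹) := by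
  intro j
  induction j with
  | zero =>
    intro _
    rw [partialMove_zero]
    rfl
  | succ j ih =>
    intro hj
    have hs := partialMove_add_one x w I ⟨j, hj⟩
    have ht := take_ofFn_succ_reverse_prod (fun i : Fin k => if i ∈ I then 1 else simpleSwap i)
      ⟨j, hj⟩
    simp only at hs ht
    rw [hs, ht, ih (by omega)]
    split_ifs with h
    · rw [one_mul]
    · rw [mul_inv_rev, simpleSwap, Equiv.swap_inv]
      rfl

theorem movedBoxes_apply (x : ℕ × ℕ) (w : Fin k → ℕ × ℕ) (I : Finset (Fin k)) (i : Fin k) :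
    movedBoxes x w I i = if i ∈ I then lastBox x w {l ∈ I | l < i} else w i := by
  have h := partialMove_eq_comp x w I k le_rfl
  rw [List.take_of_length_le (by simp)] at h
  rw [movedBoxes, vPerm, ← h, dropLast, partialMove, dif_pos (by simp)]
  rfl

theorem dropLast_partialMove (x : ℕ × ℕ) (w : Fin k → ℕ × ℕ) (I : Finset (Fin k)) :
    dropLast (partialMove x w I k) = movedBoxes x w I := by
  rw [movedBoxes, vPerm, partialMove_eq_comp x w I k le_rfl, List.take_of_length_le (by simp)]

/-- The `i`-th factor of the coefficient of the tuple moved by `v` in `T_k⁻¹ ⋯ T_1⁻¹`. -/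
noncomputable def heckeFactor (x : ℕ × ℕ) (w : Fin k → ℕ × ℕ) (I : Finset (Fin k)) (i : Fin k) :
    K :=
  if i ∈ I then
    (1 - t⁻¹) * wt (lastBox x w {l ∈ I | l < i}) / (wt (lastBox x w {l ∈ I | l < i}) - wt (w i))
  else
    (t⁻¹ * wt (lastBox x w {l ∈ I | l < i}) - wt (w i)) /
      (wt (lastBox x w {l ∈ I | l < i}) - wt (w i))

theorem filter_lt_add_one (j : Fin k) :
    (univ.filter fun i : Fin k => i.1 < j.1 + 1) =
      insert j (univ.filter fun i : Fin k => i.1 < j.1) := by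
  ext i
  simp only [mem_filter, mem_univ, true_and, mem_insert, Fin.ext_iff]
  omega

theorem isFlag_partialMove {μ : YoungDiagram} {x : ℕ × ℕ} {w : Fin k → ℕ × ℕ}
    (h : IsFlag μ (consBox x w)) (I : Finset (Fin k)) :
    ∀ j ≤ k, ∏ i : Fin k with i.1 < j, heckeFactor x w I i ≠ 0 → IsFlag μ (partialMove x w I j) := by
  intro j
  induction j with
  | zero =>
    intro _ _
    rwa [partialMove_zero]
  | succ j ih =>
    intro hj hne
    have hfl := filter_lt_add_one ⟨j, hj⟩
    have hs := partialMove_add_one x w I ⟨j, hj⟩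
    have hc := partialMove_castSucc x w I ⟨j, hj⟩
    have hsu := partialMove_succ x w I ⟨j, hj⟩
    simp only at hfl hs hc hsu
    rw [hfl, prod_insert (by simp)] at hne
    have hF := ih (by omega) (right_ne_zero_of_mul hne)
    rw [hs]
    split_ifs with hI
    · exact hF
    · by_contra hn
      have hw := wt_of_not_isFlag ⟨_, _, hF⟩ ⟨j, hj⟩ hn
      simp only [hc, hsu] at hw
      apply left_ne_zero_of_mul hne
      rw [heckeFactor, if_neg hI, hw, inv_mul_cancel_left₀ t_ne_zero, sub_self, zero_div]

theorem heckeFactor_insert {x : ℕ × ℕ} {w : Fin k → ℕ × ℕ} {I : Finset (Fin k)} {i j : Fin k}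
    (hij : i < j) : heckeFactor x w (insert j I) i = heckeFactor x w I i := by
  have h : ({l ∈ insert j I | l < i} : Finset (Fin k)) = {l ∈ I | l < i} := by
    rw [filter_insert, if_neg hij.asymm]
  simp only [heckeFactor, h, mem_insert, hij.ne, false_or]

theorem partialMove_insert (x : ℕ × ℕ) (w : Fin k → ℕ × ℕ) (I : Finset (Fin k)) (j : Fin k) :
    partialMove x w (insert j I) j = partialMove x w I j := by
  funext i
  simp only [partialMove]
  split_ifs with h1 h2 h3 h4 h5
  · congr 1
    rw [filter_insert, if_neg]
    simp only [Fin.lt_def]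
    omega
  · rcases mem_insert.1 h2 with h | h
    · simp [← h] at h1
    · exact (h3 h).elim
  · exact (h2 (mem_insert_of_mem h4)).elim
  · rfl
  · congr 1
    rw [filter_insert, if_neg (lt_irrefl _)]
  · rfl

theorem prod_heckeTInv_cls {μ : YoungDiagram} {x : ℕ × ℕ} {w : Fin k → ℕ × ℕ}
    (h : IsFlag μ (consBox x w)) :
    ∀ j ≤ k, ((List.ofFn fun i : Fin k =>
        ((heckeEquiv i).symm : Module.End K (V (k + 1)))).take j).reverse.prod
          (cls μ (consBox x w)) =
      ∑ I ∈ powerset {i : Fin k | i.1 < j},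
        (∏ i : Fin k with i.1 < j, heckeFactor x w I i) • cls μ (partialMove x w I j) := by
  intro j
  induction j with
  | zero =>
    intro _
    simp [partialMove_zero]
  | succ j ih =>
    intro hj
    have hfl := filter_lt_add_one ⟨j, hj⟩
    have hop := take_ofFn_succ_reverse_prod (fun i : Fin k =>
      ((heckeEquiv i).symm : Module.End K (V (k + 1)))) ⟨j, hj⟩
    simp only at hfl hop
    rw [hop, Module.End.mul_apply, ih (by omega), map_sum, hfl, sum_powerset_insert (by simp),
      ← sum_add_distrib]
    refine sum_congr rfl fun I hI => ?_
    have hjI : (⟨j, hj⟩ : Fin k) ∉ I := fun hm => by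
      have := mem_powerset.1 hI hm
      simp at this
    have hs := partialMove_add_one x w I ⟨j, hj⟩
    have hs' := partialMove_add_one x w (insert ⟨j, hj⟩ I) ⟨j, hj⟩
    have hins := partialMove_insert x w I ⟨j, hj⟩
    have hc := partialMove_castSucc x w I ⟨j, hj⟩
    have hsu := partialMove_succ x w I ⟨j, hj⟩
    rw [if_neg hjI] at hs
    rw [if_pos (mem_insert_self _ _)] at hs'
    simp only at hs hs' hins hc hsu
    rw [map_smul, prod_insert (by simp), prod_insert (by simp), hs, hs', hins]
    have hpr : ∏ i : Fin k with i.1 < j, heckeFactor x w (insert ⟨j, hj⟩ I) i =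
        ∏ i : Fin k with i.1 < j, heckeFactor x w I i :=
      prod_congr rfl fun i hi => heckeFactor_insert (by simpa [Fin.lt_def] using hi)
    rw [hpr]
    by_cases h0 : ∏ i : Fin k with i.1 < j, heckeFactor x w I i = 0
    · simp [h0]
    have hF := isFlag_partialMove h I j (by omega) h0
    have hT := heckeTInv_cls ⟨j, hj⟩ ⟨_, _, hF⟩
    simp only [hc, hsu] at hT
    have hsymm : ∀ v, ((heckeEquiv (⟨j, hj⟩ : Fin k)).symm : Module.End K (V (k + 1))) v =
      heckeTInv ⟨j, hj⟩ v := fun v => rfl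
    have hfi : ({l ∈ insert (⟨j, hj⟩ : Fin k) I | l < ⟨j, hj⟩} : Finset (Fin k)) =
        {l ∈ I | l < ⟨j, hj⟩} := by
      rw [filter_insert, if_neg (lt_irrefl _)]
    rw [hsymm, hT, heckeFactor, if_neg hjI, heckeFactor, if_pos (mem_insert_self _ _), hfi,
      smul_add, smul_smul, smul_smul]
    refine (add_comm _ _).trans ?_
    congr 2 <;> exact mul_comm _ _

/-- The coefficient of `H` for the shape `ξ + x` and the boxes `(v(xw))'`. -/
noncomputable def movedCoeff (P : FixedPoint k) (x : ℕ × ℕ) (I : Finset (Fin k)) : K :=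
  t ^ k * macPieri P.shape x *
    (∏ i, (wt x - q * wt (P.box i)) / (wt x - q * t * wt (P.box i))) *
      ∏ i, heckeFactor x P.box I i

/-- The class `H_{μ,w}`; zero if `(μ, w)` does not index a fixed point. -/
noncomputable def normCls (μ : YoungDiagram) (w : Fin k → ℕ × ℕ) : V k :=
  normFactor μ • cls μ w

theorem normCls_self (Q : FixedPoint k) : normCls Q.shape Q.box = H k Q := by
  rw [normCls, cls_self, H_apply]

theorem normCls_of_not (μ : YoungDiagram) (w : Fin k → ℕ × ℕ) (h : ¬ IsFlag μ w) :
    normCls μ w = 0 := by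
  rw [normCls, cls, dif_neg h, smul_zero]

theorem addable_transpose {μ : YoungDiagram} {x : ℕ × ℕ} (hx : x ∈ addable μ) :
    x.swap ∈ addable μ.transpose := by
  rw [mem_addable] at hx ⊢
  refine ⟨fun h => hx.1 (by simpa using h), fun a b hba ha => ?_⟩
  have := hx.2 (show b.swap ≤ a.swap from ⟨hba.2, hba.1⟩) (by
    rcases ha with ha | ha
    · exact Or.inl (by rw [ha, Prod.swap_swap])
    · exact Or.inr (by simpa using ha))
  rcases this with h | h
  · exact Or.inl (by rw [← h, Prod.swap_swap])
  · exact Or.inr (by simpa using h)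

theorem addBox_transpose {μ : YoungDiagram} {x : ℕ × ℕ} (hx : x ∈ addable μ) :
    (addBox μ x).transpose = addBox μ.transpose x.swap := by
  ext b
  rw [YoungDiagram.mem_cells, YoungDiagram.mem_cells, YoungDiagram.mem_transpose, mem_addBox hx,
    mem_addBox (addable_transpose hx), YoungDiagram.mem_transpose, ← Prod.swap_inj, Prod.swap_swap]

theorem nStat_eq_sum (μ : YoungDiagram) : nStat μ = ∑ b ∈ μ.cells, b.1 := by
  have hmaps : ∀ b ∈ μ.cells, b.1 ∈ range (μ.colLen 0) := fun b hb => by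
    rw [mem_range, ← YoungDiagram.mem_iff_lt_colLen]
    exact μ.isLowerSet (show ((b.1, 0) : ℕ × ℕ) ≤ b from ⟨le_rfl, Nat.zero_le _⟩) hb
  rw [nStat, ← sum_fiberwise_of_maps_to hmaps]
  refine sum_congr rfl fun r _ => ?_
  rw [sum_congr rfl fun b hb => (mem_filter.1 hb).2, sum_const, smul_eq_mul, mul_comm,
    YoungDiagram.rowLen_eq_card]
  rfl

theorem nStat_addBox {μ : YoungDiagram} {x : ℕ × ℕ} (hx : x ∈ addable μ) :
    nStat (addBox μ x) = nStat μ + x.1 := by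
  rw [nStat_eq_sum, nStat_eq_sum, addBox_cells hx, sum_insert (mem_addable.1 hx).1, add_comm]

theorem normFactor_addBox {μ : YoungDiagram} {x : ℕ × ℕ} (hx : x ∈ addable μ) :
    normFactor (addBox μ x) = -wt x * normFactor μ := by
  rw [normFactor, normFactor, card_addBox hx, addBox_transpose hx, nStat_addBox hx,
    nStat_addBox (addable_transpose hx), wt]
  simp only [Prod.fst_swap]
  ring

theorem dMinus_cls {μ : YoungDiagram} {w : Fin (k + 1) → ℕ × ℕ} (h : IsFlag μ w) :
    dMinus k (cls μ w) = cls μ (dropLast w) := by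
  have := cls_self (⟨μ, w, h⟩ : FixedPoint (k + 1))
  simp only at this
  rw [this, dMinus, Finsupp.linearCombination_single, one_smul]

theorem prod_quotient_eq_zero {P : FixedPoint k} {x : ℕ × ℕ} (hx : x ∈ addable P.shape) {i : Fin k}
    (hi : (P.box i).2 = x.2) :
    ∏ i, (wt x - q * wt (P.box i)) / (wt x - q * t * wt (P.box i)) = 0 := by
  refine prod_eq_zero (mem_univ i) ?_
  have h1 : wt x = q * wt (P.box i) := by
    have h2 := P.isFlag.colLen i
    rw [hi, addable_colLen hx] at h2
    rw [wt, wt, h2, hi]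
    ring
  rw [h1, sub_self, zero_div]

theorem eOne_H (P : FixedPoint k) :
    eOne k (H k P) = ∑ x ∈ addable P.shape, ∑ I : Finset (Fin k),
      movedCoeff P x I • normCls (addBox P.shape x) (movedBoxes x P.box I) := by
  rw [eOne, LinearMap.comp_apply, LinearMap.comp_apply, H_apply, map_smul, dPlus,
    Finsupp.linearCombination_single, one_smul, smul_sum, smul_sum, map_sum, map_sum]
  refine sum_congr rfl fun x hx => ?_
  rw [map_smul, map_smul, map_smul, map_smul, map_smul, map_smul, smul_smul, smul_smul]
  by_cases hc : ∀ i, (P.box i).2 ≠ x.2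
  · have hF := isFlag_consBox hx P.isFlag hc
    have hop := prod_heckeTInv_cls hF k le_rfl
    rw [List.take_of_length_le (by simp)] at hop
    have hu : ({i : Fin k | i.1 < k} : Finset (Fin k)) = univ := by simp
    rw [hop, map_sum, smul_sum, hu, powerset_univ]
    refine sum_congr rfl fun I _ => ?_
    rw [map_smul, smul_smul, normCls, smul_smul]
    by_cases h0 : ∏ i, heckeFactor x P.box I i = 0
    · simp [movedCoeff, h0]
    have hM := isFlag_partialMove hF I k le_rfl (by rwa [hu])
    rw [dMinus_cls hM, dropLast_partialMove, movedCoeff, normFactor_addBox hx]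
    congr 1
    ring
  · push Not at hc
    obtain ⟨i, hi⟩ := hc
    simp [movedCoeff, prod_quotient_eq_zero hx hi]

theorem box_ne_of_addable {P : FixedPoint k} {x : ℕ × ℕ} (hx : x ∈ addable P.shape) (i : Fin k) :
    P.box i ≠ x := fun h => (mem_addable.1 hx).1 (h ▸ P.isFlag.mem i)

theorem lastBox_ne {P : FixedPoint k} {x : ℕ × ℕ} (hx : x ∈ addable P.shape) {I : Finset (Fin k)}
    {i : Fin k} (hI : i ∉ I) : lastBox x P.box I ≠ P.box i := by
  rw [lastBox]
  split_ifs with h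
  · exact fun e => hI (P.isFlag.col_injective (congrArg Prod.snd e) ▸ I.max'_mem h)
  · exact (box_ne_of_addable hx i).symm

theorem movedBoxes_injective {P : FixedPoint k} {x : ℕ × ℕ} (hx : x ∈ addable P.shape) :
    Function.Injective (movedBoxes x P.box) := by
  intro I J h
  ext i
  have hi := congrFun h i
  rw [movedBoxes_apply, movedBoxes_apply] at hi
  have hl : ∀ A : Finset (Fin k), lastBox x P.box {l ∈ A | l < i} ≠ P.box i := fun A =>
    lastBox_ne hx (by simp)
  split_ifs at hi with h1 h2 h2
  · exact iff_of_true h1 h2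
  · exact (hl _ hi).elim
  · exact (hl _ hi.symm).elim
  · exact iff_of_false h1 h2

theorem addBox_injective {μ : YoungDiagram} {x y : ℕ × ℕ} (hx : x ∈ addable μ)
    (hy : y ∈ addable μ) (h : addBox μ x = addBox μ y) : x = y := by
  have h1 : x ∈ addBox μ y := h ▸ (mem_addBox hx).2 (Or.inl rfl)
  exact ((mem_addBox hy).1 h1).resolve_right (mem_addable.1 hx).1

theorem repr_normCls (μ : YoungDiagram) (w : Fin k → ℕ × ℕ) (Q : FixedPoint k) :
    (H k).repr (normCls μ w) Q = open Classical in if μ = Q.shape ∧ w = Q.box then 1 else 0 := by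
  classical
  by_cases h : IsFlag μ w
  · have h1 := normCls_self ⟨μ, w, h⟩
    simp only at h1
    rw [h1, Module.Basis.repr_self, Finsupp.single_apply]
    simp only [FixedPoint.ext_iff]
  · rw [normCls_of_not μ w h, map_zero, Finsupp.zero_apply, if_neg]
    rintro ⟨rfl, rfl⟩
    exact h Q.isFlag

theorem geomCoeff_eq (P Q : FixedPoint k) {x : ℕ × ℕ} (hx : x ∈ addable P.shape)
    (I : Finset (Fin k)) (h1 : Q.shape = addBox P.shape x) (h2 : Q.box = movedBoxes x P.box I) :
    geomCoeff P Q = movedCoeff P x I := by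
  classical
  rw [geomCoeff, eOne_H, map_sum, Finsupp.finsetSum_apply, sum_eq_single_of_mem x hx]
  · rw [map_sum, Finsupp.finsetSum_apply, sum_eq_single_of_mem I (mem_univ I)]
    · rw [map_smul, Finsupp.smul_apply, repr_normCls, if_pos ⟨h1.symm, h2.symm⟩, smul_eq_mul,
        mul_one]
    · intro J _ hJ
      rw [map_smul, Finsupp.smul_apply, repr_normCls, if_neg, smul_zero]
      rintro ⟨-, h⟩
      exact hJ (movedBoxes_injective hx (h.trans h2))
  · intro y hy hyx
    rw [map_sum, Finsupp.finsetSum_apply]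
    refine sum_eq_zero fun J _ => ?_
    rw [map_smul, Finsupp.smul_apply, repr_normCls, if_neg, smul_zero]
    rintro ⟨h, -⟩
    exact hyx (addBox_injective hy hx (h.trans h1))

theorem eOne_H_eq_sum (P : FixedPoint k) :
    eOne k (H k P) = ∑ x ∈ addable P.shape, ∑ I : Finset (Fin k),
      ∑ᶠ h : IsFlag (addBox P.shape x) (movedBoxes x P.box I),
        geomCoeff P ⟨_, _, h⟩ • H k ⟨_, _, h⟩ := by
  classical
  rw [eOne_H]
  refine sum_congr rfl fun x hx => sum_congr rfl fun I _ => ?_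
  rw [finsum_eq_dif]
  split_ifs with h
  · rw [geomCoeff_eq P ⟨_, _, h⟩ hx I rfl rfl, ← normCls_self]
  · rw [normCls_of_not _ _ h, smul_zero]

end PFH

namespace PFH

variable {k : ℕ}

/-! ### Counting in lists -/

theorem map_part_range (ν : List ℕ) : (List.range ν.length).map (part ν) = ν := by
  refine List.ext_getElem (by simp) fun i h1 h2 => ?_
  simp [part, h2]

theorem card_filter_range_eq_countP (n : ℕ) (p : ℕ → Prop) [DecidablePred p] :
    #{i ∈ range n | p i} = (List.range n).countP p := by
  rw [List.countP_eq_length_filter]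
  rfl

theorem card_range_part (ν : List ℕ) (p : ℕ → Prop) [DecidablePred p] {i : ℕ}
    (hi : i ≤ ν.length) : #{r ∈ range i | p (part ν r)} = (ν.take i).countP p := by
  conv_rhs => rw [← map_part_range ν]
  rw [card_filter_range_eq_countP, ← List.map_take, List.countP_map, List.take_range,
    min_eq_left hi]
  rfl

theorem card_Ioo_part (ν : List ℕ) (p : ℕ → Prop) [DecidablePred p] (i : ℕ) :
    #{r ∈ Ioo i ν.length | p (part ν r)} = (ν.drop (i + 1)).countP p := by
  have h := card_range_part (ν.drop (i + 1)) p le_rfl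
  rw [List.take_length] at h
  rw [← h, List.length_drop]
  refine (card_nbij (fun r => i + 1 + r) (fun r hr => ?_) (fun a _ b _ hab => ?_)
    fun r hr => ?_).symm
  · simp only [coe_filter, mem_range, Set.mem_ofPred_eq, mem_Ioo] at hr ⊢
    refine ⟨by omega, ?_⟩
    simpa [part, List.getD_eq_getElem?_getD, List.getElem?_drop] using hr.2
  · simpa using hab
  · simp only [coe_filter, mem_Ioo, Set.mem_ofPred_eq] at hr
    refine ⟨r - (i + 1), ?_, by simp only; omega⟩
    simp only [coe_filter, mem_range, Set.mem_ofPred_eq]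
    refine ⟨by omega, ?_⟩
    have e : i + 1 + (r - (i + 1)) = r := by omega
    simpa [part, List.getD_eq_getElem?_getD, List.getElem?_drop, e] using hr.2

theorem countP_ofFn (γ : Fin k → ℕ) (p : ℕ → Prop) [DecidablePred p] :
    (List.ofFn γ).countP p = #{i | p (γ i)} := by
  rw [List.ofFn_eq_map, List.countP_map, List.countP_eq_length_filter]
  rfl

theorem countP_take_ofFn (γ : Fin k → ℕ) (p : ℕ → Prop) [DecidablePred p] (j : Fin k) :
    ((List.ofFn γ).take j).countP p = #{i | i < j ∧ p (γ i)} := by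
  rw [← card_range_part _ _ (by simp)]
  refine (card_nbij (fun i : Fin k => i.1) (fun i hi => ?_) (fun a _ b _ hab => Fin.ext hab)
    fun r hr => ?_).symm
  · simp only [coe_filter, mem_univ, true_and, Set.mem_ofPred_eq, mem_range] at hi ⊢
    exact ⟨hi.1, by simpa [part] using hi.2⟩
  · simp only [coe_filter, mem_range, Set.mem_ofPred_eq] at hr
    have hrk : r < k := hr.1.trans j.2
    refine ⟨⟨r, hrk⟩, ?_, rfl⟩
    simp only [coe_filter, mem_univ, true_and, Set.mem_ofPred_eq]
    exact ⟨hr.1, by simpa [part, hrk] using hr.2⟩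

theorem countP_drop_ofFn (γ : Fin k → ℕ) (p : ℕ → Prop) [DecidablePred p] (j : Fin k) :
    ((List.ofFn γ).drop (j + 1)).countP p = #{i | j < i ∧ p (γ i)} := by
  rw [← card_Ioo_part]
  refine (card_nbij (fun i : Fin k => i.1) (fun i hi => ?_) (fun a _ b _ hab => Fin.ext hab)
    fun r hr => ?_).symm
  · simp only [coe_filter, mem_univ, true_and, Set.mem_ofPred_eq, mem_Ioo, List.length_ofFn] at hi ⊢
    exact ⟨⟨hi.1, i.2⟩, by simpa [part] using hi.2⟩
  · simp only [coe_filter, mem_Ioo, Set.mem_ofPred_eq, List.length_ofFn] at hr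
    have hrk : r < k := hr.1.2
    refine ⟨⟨r, hrk⟩, ?_, rfl⟩
    simp only [coe_filter, mem_univ, true_and, Set.mem_ofPred_eq]
    exact ⟨hr.1.1, by simpa [part, hrk] using hr.2⟩

theorem coleg_eq (ν : List ℕ) {i : ℕ} (hi : i ≤ ν.length) :
    coleg ν i = (ν.take i).countP (part ν i < ·) + (ν.drop (i + 1)).countP (part ν i ≤ ·) := by
  rw [coleg, card_range_part _ (part ν i < ·) hi, card_Ioo_part _ (part ν i ≤ ·)]

theorem part_append_ofFn (M : List ℕ) (γ : Fin k → ℕ) (j : Fin k) :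
    part (M ++ List.ofFn γ) (M.length + j) = γ j := by
  simp [part]

theorem part_append_of_lt {M : List ℕ} (N : List ℕ) {i : ℕ} (hi : i < M.length) :
    part (M ++ N) i = part M i := by
  simp [part, List.getElem?_append_left hi]

theorem coleg_append_ofFn (M : List ℕ) (γ : Fin k → ℕ) (j : Fin k) :
    coleg (M ++ List.ofFn γ) (M.length + j) =
      M.countP (γ j < ·) + #{i | i < j ∧ γ j < γ i} + #{i | j < i ∧ γ j ≤ γ i} := by
  rw [coleg_eq _ (by simp), part_append_ofFn, List.take_length_add_append, List.countP_append,
    countP_take_ofFn γ (γ j < ·), add_assoc M.length, List.drop_length_add_append,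
    countP_drop_ofFn γ (γ j ≤ ·)]

/-! ### Columns without labeled box -/

/-- The columns below `n` that contain no labeled box. -/
def freeCols (P : FixedPoint k) (n : ℕ) : Finset ℕ := {c ∈ range n | ∀ i, (P.box i).2 ≠ c}

theorem box_snd_lt {P : FixedPoint k} {n : ℕ} (hn : P.shape.card ≤ n) (i : Fin k) :
    (P.box i).2 < n := (snd_lt_card (P.isFlag.mem i)).trans_le hn

@[to_additive]
theorem prod_range_eq_freeCols {M : Type*} [CommMonoid M] {P : FixedPoint k} {n : ℕ}
    (hn : P.shape.card ≤ n) (f : ℕ → M) :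
    ∏ c ∈ range n, f c = (∏ c ∈ freeCols P n, f c) * ∏ i, f (P.box i).2 := by
  rw [freeCols, ← prod_filter_mul_prod_filter_not (range n) fun c => ∀ i, (P.box i).2 ≠ c]
  congr 1
  refine (prod_nbij (fun i => (P.box i).2) (fun i _ => ?_)
    (fun i _ j _ hij => P.isFlag.col_injective hij) (fun c hc => ?_) fun _ _ => rfl).symm
  · simp only [mem_filter, mem_range]
    exact ⟨box_snd_lt hn i, fun h => h i rfl⟩
  · simp only [coe_filter, mem_range, Set.mem_ofPred_eq] at hc
    push Not at hc
    obtain ⟨-, i, hi⟩ := hc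
    exact ⟨i, by simp, hi⟩

theorem card_range_eq_freeCols {P : FixedPoint k} {n : ℕ} (hn : P.shape.card ≤ n)
    (R : ℕ → Prop) [DecidablePred R] :
    #{c ∈ range n | R c} = #{c ∈ freeCols P n | R c} + #{i | R (P.box i).2} := by
  simp only [card_filter]
  exact sum_range_eq_freeCols hn _

theorem card_freeCols {P : FixedPoint k} {n : ℕ} (hn : P.shape.card ≤ n) :
    #(freeCols P n) = n - k := by
  have := card_range_eq_freeCols hn fun _ => True
  simp only [filter_true, card_range, card_univ, Fintype.card_fin] at this
  omega

theorem map_nth_range_count (p : ℕ → Prop) [DecidablePred p] (n : ℕ) :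
    (List.range (Nat.count p n)).map (Nat.nth p) = (List.range n).filter p := by
  induction n with
  | zero => simp
  | succ n ih =>
    rw [Nat.count_succ, List.range_succ, List.filter_append, ← ih]
    split_ifs with h
    · rw [List.range_succ, List.map_append]
      simp [h, Nat.nth_count]
    · simp [h]

theorem count_free {P : FixedPoint k} {n : ℕ} (hn : P.shape.card ≤ n) :
    Nat.count (fun c => ∀ i, (P.box i).2 ≠ c) n = n - k := by
  rw [Nat.count_eq_card_filter_range, ← card_freeCols hn, freeCols]

theorem lam_eq {P : FixedPoint k} {n : ℕ} (hn : P.shape.card ≤ n) :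
    lam P (n - k) =
      ((List.range n).filter fun c => ∀ i, (P.box i).2 ≠ c).map P.shape.colLen := by
  rw [← map_nth_range_count, count_free hn, List.map_map]
  rfl

theorem coe_lam {P : FixedPoint k} {n : ℕ} (hn : P.shape.card ≤ n) :
    (lam P (n - k) : Multiset ℕ) = (freeCols P n).val.map P.shape.colLen := by
  rw [lam_eq hn, ← Multiset.map_coe]
  rfl

theorem length_lam (P : FixedPoint k) (m : ℕ) : (lam P m).length = m := by simp [lam]

theorem countP_lam {P : FixedPoint k} {n : ℕ} (hn : P.shape.card ≤ n) (p : ℕ → Prop)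
    [DecidablePred p] : (lam P (n - k)).countP p = #{c ∈ freeCols P n | p (P.shape.colLen c)} := by
  rw [← Multiset.coe_countP, coe_lam hn, Multiset.countP_map]
  rfl

theorem mem_lam {P : FixedPoint k} {n : ℕ} (hn : P.shape.card ≤ n) {L : ℕ} :
    L ∈ lam P (n - k) ↔ ∃ c ∈ freeCols P n, P.shape.colLen c = L := by
  rw [← Multiset.mem_coe, coe_lam hn, Multiset.mem_map]
  rfl

theorem lam_pairwise {P : FixedPoint k} {n : ℕ} (hn : P.shape.card ≤ n) :
    (lam P (n - k)).Pairwise (· ≥ ·) := by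
  rw [lam_eq hn, List.pairwise_map]
  exact (List.pairwise_lt_range.filter _).imp fun h => P.shape.colLen_anti _ _ h.le

theorem infinite_free (P : FixedPoint k) : (Set.ofPred fun c => ∀ i, (P.box i).2 ≠ c).Infinite := by
  have h : (Set.range fun i => (P.box i).2).Finite := Set.finite_range _
  refine h.infinite_compl.mono fun c (hc : c ∈ (Set.range _)ᶜ) i e => hc ⟨i, e⟩

/-- The `j`-th column without labeled box. -/
noncomputable def freeCol (P : FixedPoint k) (j : ℕ) : ℕ :=
  Nat.nth (fun c => ∀ i, (P.box i).2 ≠ c) j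

theorem freeCol_strictMono (P : FixedPoint k) : StrictMono (freeCol P) :=
  Nat.nth_strictMono (infinite_free P)

theorem freeCol_free (P : FixedPoint k) (j : ℕ) (i : Fin k) : (P.box i).2 ≠ freeCol P j :=
  Nat.nth_mem_of_infinite (infinite_free P) j i

theorem freeCol_mem {P : FixedPoint k} {n : ℕ} (hn : P.shape.card ≤ n) {j : ℕ} :
    freeCol P j ∈ freeCols P n ↔ j < n - k := by
  rw [freeCols, mem_filter, mem_range, and_iff_left (freeCol_free P j), ← count_free hn,
    Nat.lt_nth_iff_count_lt (infinite_free P), freeCol]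

theorem exists_freeCol {P : FixedPoint k} {c : ℕ} (hc : ∀ i, (P.box i).2 ≠ c) :
    ∃ j, freeCol P j = c :=
  ⟨_, Nat.nth_count (p := fun c => ∀ i, (P.box i).2 ≠ c) hc⟩

theorem part_lam (P : FixedPoint k) {m j : ℕ} (hj : j < m) :
    part (lam P m) j = P.shape.colLen (freeCol P j) := by
  simp [part, lam, hj, freeCol]

end PFH

namespace PFH

variable {k : ℕ}

/-! ### Support of the Pieri rule -/

theorem lastVal_empty (γ : Fin k → ℕ) (L : ℕ) : lastVal γ L ∅ = L := by
  simp [lastVal]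

theorem lastVal_of_max {γ : Fin k → ℕ} {L : ℕ} {I : Finset (Fin k)} {a : Fin k}
    (ha : a ∈ I) (hmax : ∀ i ∈ I, i ≤ a) : lastVal γ L I = γ a := by
  have h : I.Nonempty := ⟨a, ha⟩
  rw [lastVal, dif_pos h]
  congr 1
  exact le_antisymm (hmax _ (I.max'_mem h)) (I.le_max' _ ha)

theorem etaOf_insert {γ : Fin k → ℕ} {L : ℕ} {I : Finset (Fin k)} {a : Fin k}
    (ha : ∀ i ∈ I, i < a) :
    etaOf γ L (insert a I) = Function.update (etaOf γ L I) a (lastVal γ L I) := by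
  funext i
  rcases lt_trichotomy i a with h | h | h
  · rw [Function.update_of_ne h.ne, etaOf, etaOf, filter_insert, if_neg h.asymm]
    simp [h.ne]
  · subst h
    rw [Function.update_self, etaOf, if_pos (mem_insert_self _ _), filter_insert,
      if_neg (lt_irrefl _), filter_true_of_mem ha]
  · have hi : i ∉ I := fun hi => h.asymm (ha i hi)
    rw [Function.update_of_ne h.ne', etaOf, etaOf, if_neg hi, if_neg]
    simp [hi, h.ne']

theorem sum_etaOf (γ : Fin k → ℕ) (L : ℕ) (I : Finset (Fin k)) (f : ℕ → ℕ) :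
    ∑ i, f (etaOf γ L I i) + f (lastVal γ L I) = ∑ i, f (γ i) + f L := by
  induction I using Finset.induction_on_max with
  | empty => simp [etaOf, lastVal_empty]
  | insert a I ha ih =>
    have hmax : ∀ i ∈ insert a I, i ≤ a := fun i hi =>
      (mem_insert.1 hi).elim (fun h => h.le) fun h => (ha i h).le
    have haI : a ∉ I := fun h => lt_irrefl _ (ha a h)
    have hg : etaOf γ L I a = γ a := by rw [etaOf, if_neg haI]
    rw [lastVal_of_max (mem_insert_self a I) hmax, etaOf_insert ha, ← ih,
      ← add_sum_erase univ (fun i => f (etaOf γ L I i)) (mem_univ a),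
      ← add_sum_erase univ _ (mem_univ a), Function.update_self, hg]
    rw [sum_congr rfl fun i hi => by rw [Function.update_of_ne (mem_erase.1 hi).1]]
    omega

theorem muTilde_perm (l : List ℕ) (γ : Fin k → ℕ) (L : ℕ) (I : Finset (Fin k)) :
    (muTilde l γ L I).Perm ((lastVal γ L I + 1) :: l.erase L) := by
  rw [muTilde]
  generalize lastVal γ L I + 1 = T
  generalize l.erase L = M
  refine ((List.perm_insertionSort _ _).append_right _).trans ?_
  rw [List.replicate_succ]
  refine List.perm_middle.trans (List.Perm.cons T ?_)
  rw [← List.filter_eq]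
  refine List.perm_append_comm.trans ?_
  convert List.filter_append_perm (fun a => decide (a = T)) M using 2
  simp only [ne_eq, decide_not]

theorem sum_muTilde {l : List ℕ} {γ : Fin k → ℕ} {L : ℕ} {I : Finset (Fin k)} (hL : L ∈ l)
    (f : ℕ → ℕ) :
    ((muTilde l γ L I).map f).sum + f L = (l.map f).sum + f (lastVal γ L I + 1) := by
  rw [((muTilde_perm l γ L I).map f).sum_eq, ((List.perm_cons_erase hL).map f).sum_eq]
  simp only [List.map_cons, List.sum_cons]
  omega

theorem IsMaximal.mem_iff {γ : Fin k → ℕ} {L : ℕ} {I : Finset (Fin k)} (h : IsMaximal γ L I)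
    (s : Fin k) : s ∈ I ↔ γ s = lastVal γ L {i ∈ I | i ≤ s} := by
  constructor
  · intro hs
    exact (lastVal_of_max (by simp [hs]) (by simp)).symm
  · intro e
    by_contra hs
    have hes : etaOf γ L I s = γ s := by rw [etaOf, if_neg hs]
    rcases ({i ∈ I | s < i} : Finset (Fin k)).eq_empty_or_nonempty with h0 | h0
    · have hlt : ∀ i ∈ I, i < s := fun i hi => by
        have : ¬ s < i := fun hsi => by
          have : i ∈ ({i ∈ I | s < i} : Finset (Fin k)) := mem_filter.2 ⟨hi, hsi⟩
          rw [h0] at this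
          exact notMem_empty _ this
        exact lt_of_le_of_ne (not_lt.1 this) fun e => hs (e ▸ hi)
      refine h.2 s (by simpa [tailGap] using hlt) ?_
      rw [hes, e, filter_true_of_mem fun i hi => (hlt i hi).le]
    · obtain ⟨u, ht, htm⟩ : ∃ u ∈ ({i ∈ I | s < i} : Finset (Fin k)),
          ∀ i ∈ ({i ∈ I | s < i} : Finset (Fin k)), u ≤ i :=
        ⟨_, min'_mem _ h0, fun i hi => min'_le _ i hi⟩
      rw [mem_filter] at ht
      have hlt : ∀ i ∈ I, i < u → i < s := fun i hi hiu => by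
        by_contra! hsi
        have : s < i := lt_of_le_of_ne hsi fun e => hs (e ▸ hi)
        exact absurd (htm i (mem_filter.2 ⟨hi, this⟩)) (not_le.2 hiu)
      refine h.1 u ht.1 s (by simpa [gap] using ⟨ht.2, hlt⟩) ?_
      rw [hes, e, etaOf, if_pos ht.1]
      congr 1
      ext i
      simp only [mem_filter, and_congr_right_iff]
      exact fun hi => ⟨fun h => h.trans_lt ht.2, fun h => (hlt i hi h).le⟩

theorem eq_of_etaOf_eq {γ : Fin k → ℕ} {L : ℕ} {I J : Finset (Fin k)} (hI : IsMaximal γ L I)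
    (hJ : IsMaximal γ L J) (he : etaOf γ L I = etaOf γ L J)
    (hl : lastVal γ L I = lastVal γ L J) : I = J := by
  have key : ∀ d ≤ k, (∀ i : Fin k, k - d ≤ i.1 → (i ∈ I ↔ i ∈ J)) ∧
      lastVal γ L {i ∈ I | i.1 < k - d} = lastVal γ L {i ∈ J | i.1 < k - d} := by
    intro d
    induction d with
    | zero =>
      intro _
      refine ⟨fun i hi => absurd i.2 (by omega), ?_⟩
      simpa using hl
    | succ d ih =>
      intro hd
      obtain ⟨h1, h2⟩ := ih (by omega)
      have hs : k - (d + 1) < k := by omega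
      have hfi : ∀ A : Finset (Fin k), ({i ∈ A | i.1 < k - d} : Finset (Fin k)) =
          {i ∈ A | i ≤ ⟨k - (d + 1), hs⟩} := fun A => by
        ext i
        simp only [mem_filter, and_congr_right_iff, Fin.le_def]
        omega
      rw [hfi, hfi] at h2
      have hmem : (⟨k - (d + 1), hs⟩ : Fin k) ∈ I ↔ (⟨k - (d + 1), hs⟩ : Fin k) ∈ J := by
        rw [hI.mem_iff, hJ.mem_iff, h2]
      refine ⟨fun i hi => ?_, ?_⟩
      · rcases hi.lt_or_eq with h | h
        · exact h1 i (by omega)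
        · have : i = ⟨k - (d + 1), hs⟩ := Fin.ext h.symm
          rwa [this]
      · by_cases hsI : (⟨k - (d + 1), hs⟩ : Fin k) ∈ I
        · have := congrFun he ⟨k - (d + 1), hs⟩
          rw [etaOf, etaOf, if_pos hsI, if_pos (hmem.1 hsI)] at this
          simpa only [Fin.lt_def] using this
        · have hlt : ∀ A : Finset (Fin k), (⟨k - (d + 1), hs⟩ : Fin k) ∉ A →
              ({i ∈ A | i.1 < k - (d + 1)} : Finset (Fin k)) =
                {i ∈ A | i ≤ ⟨k - (d + 1), hs⟩} := fun A hA => by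
            ext i
            simp only [mem_filter, and_congr_right_iff, Fin.le_def]
            intro hi
            have : i.1 ≠ k - (d + 1) := fun e => hA (by
              rwa [← show i = ⟨k - (d + 1), hs⟩ from Fin.ext e])
            omega
          rw [hlt I hsI, hlt J fun h => hsI (hmem.2 h), h2]
  ext i
  exact (key k le_rfl).1 i (by omega)

theorem IsPieriDatum.unique {l mu : List ℕ} {γ η : Fin k → ℕ} {L L' : ℕ} {I I' : Finset (Fin k)}
    (h : IsPieriDatum l γ mu η L I) (h' : IsPieriDatum l γ mu η L' I') : L = L' ∧ I = I' := by
  obtain ⟨hL, he, hm, hp, -⟩ := h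
  obtain ⟨hL', he', hm', hp', -⟩ := h'
  have e1 : ∀ f : ℕ → ℕ, f (lastVal γ L I + 1) + f L' = f (lastVal γ L' I' + 1) + f L := by
    intro f
    have a1 := sum_muTilde (γ := γ) (I := I) hL f
    have a2 := sum_muTilde (γ := γ) (I := I') hL' f
    have a3 := ((hp.symm.trans hp').map f).sum_eq
    omega
  have e2 : ∀ f : ℕ → ℕ, f L + f (lastVal γ L' I') = f L' + f (lastVal γ L I) := by
    intro f
    have a1 := sum_etaOf γ L I f
    have a2 := sum_etaOf γ L' I' f
    rw [← he] at a1
    rw [← he'] at a2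
    omega
  have hLL : L = L' := by
    by_contra hne
    have a1 := e1 fun v => if v = L then 1 else 0
    have a2 := e2 fun v => if v = L then 1 else 0
    simp only [if_neg (Ne.symm hne), if_true] at a1 a2
    split_ifs at a1 a2 <;> omega
  subst hLL
  refine ⟨rfl, eq_of_etaOf_eq hm hm' (he.symm.trans he') ?_⟩
  have a2 := e2 fun v => if v = lastVal γ L I then 1 else 0
  simp only [if_true] at a2
  split_ifs at a2 <;> omega

theorem pieriCoeff_eq {l mu : List ℕ} {γ η : Fin k → ℕ} {L : ℕ} {I : Finset (Fin k)}
    (h : IsPieriDatum l γ mu η L I) : pieriCoeff l γ mu η = pieriTerm l γ L I := by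
  have hex : ∃ d : ℕ × Finset (Fin k), IsPieriDatum l γ mu η d.1 d.2 := ⟨(L, I), h⟩
  rw [pieriCoeff, dif_pos hex]
  obtain ⟨h1, h2⟩ := hex.choose_spec.unique h
  rw [h1, h2]

/-! ### Fixed points obtained by adding a box -/

theorem fst_lastBox (x : ℕ × ℕ) (P : FixedPoint k) (I : Finset (Fin k)) :
    (lastBox x P.box I).1 = lastVal (gam P) x.1 I := by
  rw [lastBox, lastVal]
  split_ifs <;> rfl

theorem gam_eq_etaOf {P Q : FixedPoint k} {x : ℕ × ℕ} {I : Finset (Fin k)}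
    (h : Q.box = movedBoxes x P.box I) : gam Q = etaOf (gam P) x.1 I := by
  funext i
  rw [gam, h, movedBoxes_apply, etaOf]
  split_ifs
  · exact fst_lastBox _ _ _
  · rfl

theorem lastBox_eq_consBox (x : ℕ × ℕ) (w : Fin k → ℕ × ℕ) (I : Finset (Fin k)) :
    ∃ a, lastBox x w I = consBox x w a ∧ ∀ j : Fin k, (∀ i ∈ I, i < j) → a < j.succ := by
  rw [lastBox]
  split_ifs with h
  · exact ⟨(I.max' h).succ, rfl, fun j hj => Fin.succ_lt_succ_iff.2 (hj _ (I.max'_mem h))⟩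
  · exact ⟨0, rfl, fun j _ => Fin.succ_pos j⟩

theorem pieriCoeff_of_not_free {P Q : FixedPoint k} {x : ℕ × ℕ} {I : Finset (Fin k)} {n : ℕ}
    (hn : P.shape.card < n) (hx : x ∈ addable P.shape) (h1 : Q.shape = addBox P.shape x)
    (h2 : Q.box = movedBoxes x P.box I) {a : Fin k} (ha : (P.box a).2 = x.2) :
    pieriCoeff (lam P (n - k)) (gam P) (lam Q (n - k)) (gam Q) = 0 := by
  rw [pieriCoeff, dif_neg]
  rintro ⟨⟨L, J⟩, hL, he, -⟩
  simp only at hL he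
  have hrow : (P.box a).1 + 1 = x.1 := by
    rw [← P.isFlag.colLen, ha, addable_colLen hx]
  have hQ : ∀ j, Q.box j ≠ P.box a := fun j e => by
    have := Q.isFlag.colLen j
    rw [e, ha, h1, colLen_addBox_self hx] at this
    omega
  have haI : a ∈ I := by
    by_contra h
    refine hQ a ?_
    rw [h2, movedBoxes_apply, if_neg h]
  have hmax : ∀ i ∈ I, i ≤ a := by
    by_contra! hcon
    obtain ⟨b, hb, hab⟩ := hcon
    have hne : ({i ∈ I | a < i} : Finset (Fin k)).Nonempty := ⟨b, mem_filter.2 ⟨hb, hab⟩⟩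
    obtain ⟨s, hs, hsm⟩ : ∃ s ∈ ({i ∈ I | a < i} : Finset (Fin k)),
        ∀ i ∈ ({i ∈ I | a < i} : Finset (Fin k)), s ≤ i :=
      ⟨_, min'_mem _ hne, fun i hi => min'_le _ i hi⟩
    rw [mem_filter] at hs
    refine hQ s ?_
    rw [h2, movedBoxes_apply, if_pos hs.1]
    refine lastBox_of_max (by simp [haI, hs.2]) fun i hi => ?_
    rw [mem_filter] at hi
    by_contra! hai
    exact absurd (hsm i (mem_filter.2 ⟨hi.1, hai⟩)) (not_le.2 hi.2)
  have hv : lastVal (gam P) x.1 I = (P.box a).1 := lastVal_of_max haI hmax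
  have hLx : L = x.1 := by
    have e1 := sum_etaOf (gam P) x.1 I fun v => if v = x.1 then 1 else 0
    have e2 := sum_etaOf (gam P) L J fun v => if v = x.1 then 1 else 0
    rw [← gam_eq_etaOf h2, hv, if_neg (by omega), if_pos rfl] at e1
    rw [← he] at e2
    split_ifs at e2 <;> omega
  obtain ⟨c, hc, hcL⟩ := (mem_lam hn.le).1 hL
  have hlt := P.isFlag.lt_snd_of_free (i := a) (mem_filter.1 hc).2 (by omega)
  rw [ha, ← addable_rowLen hx, lt_rowLen_iff_lt_colLen] at hlt
  omega

/-- The fixed point `Q` arises from `P` by adding the box `x`, in a column without labeled box, and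
moving labels by `v`. -/
structure IsMove (P : FixedPoint k) (x : ℕ × ℕ) (I : Finset (Fin k)) (Q : FixedPoint k) : Prop where
  mem : x ∈ addable P.shape
  shape : Q.shape = addBox P.shape x
  box : Q.box = movedBoxes x P.box I
  free : ∀ i, (P.box i).2 ≠ x.2

variable {P Q : FixedPoint k} {x : ℕ × ℕ} {I : Finset (Fin k)} {n : ℕ}

theorem IsMove.isFlag (h : IsMove P x I Q) : IsFlag Q.shape (consBox x P.box) := by
  rw [h.shape]
  exact isFlag_consBox h.mem P.isFlag h.free

theorem lastBox_eq_vPerm (x : ℕ × ℕ) (w : Fin k → ℕ × ℕ) (I : Finset (Fin k)) :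
    lastBox x w I = consBox x w ((vPerm I)⁻¹ (Fin.last k)) := by
  have h := congrFun (partialMove_eq_comp x w I k le_rfl) (Fin.last k)
  rw [List.take_of_length_le (by simp), partialMove, dif_neg (by simp), if_pos (by simp)] at h
  simpa [vPerm] using h

theorem IsMove.free_iff (h : IsMove P x I Q) (c : ℕ) :
    (∀ i, (Q.box i).2 ≠ c) ↔
      c = (lastBox x P.box I).2 ∨ (c ≠ x.2 ∧ ∀ i, (P.box i).2 ≠ c) := by
  have hall : (c ≠ x.2 ∧ ∀ i, (P.box i).2 ≠ c) ↔
      (c ≠ (lastBox x P.box I).2 ∧ ∀ i, (Q.box i).2 ≠ c) := by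
    have e1 : (∀ i, (consBox x P.box i).2 ≠ c) ↔ (c ≠ x.2 ∧ ∀ i, (P.box i).2 ≠ c) := by
      rw [Fin.forall_fin_succ, ne_comm]
      rfl
    have e2 : (∀ i, (consBox x P.box ((vPerm I)⁻¹ i)).2 ≠ c) ↔
        (c ≠ (lastBox x P.box I).2 ∧ ∀ i, (Q.box i).2 ≠ c) := by
      rw [Fin.forall_fin_succ', and_comm, h.box, ← lastBox_eq_vPerm, ne_comm]
      rfl
    rw [← e1, ← e2]
    exact (Equiv.forall_congr_right (vPerm I)⁻¹).symm
  rw [hall]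
  by_cases hc : c = (lastBox x P.box I).2
  · simp only [hc, true_or, iff_true]
    intro i e
    rw [h.box, lastBox_eq_vPerm] at e
    have := (vPerm I)⁻¹.injective (h.isFlag.col_injective e)
    exact (Fin.castSucc_lt_last i).ne this
  · simp [hc]

theorem IsMove.lastBox_free (h : IsMove P x I Q) (i : Fin k) :
    (Q.box i).2 ≠ (lastBox x P.box I).2 := (h.free_iff _).2 (Or.inl rfl) i

theorem IsMove.colLen_lastBox (h : IsMove P x I Q) :
    Q.shape.colLen (lastBox x P.box I).2 = (lastBox x P.box I).1 + 1 := by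
  rw [lastBox_eq_vPerm]
  exact h.isFlag.colLen _

theorem IsMove.card_le (h : IsMove P x I Q) (hn : P.shape.card < n) : Q.shape.card ≤ n := by
  rw [h.shape, card_addBox h.mem]
  exact hn

theorem IsMove.lastBox_lt (h : IsMove P x I Q) (hn : P.shape.card < n) :
    (lastBox x P.box I).2 < n := by
  rw [lastBox_eq_vPerm]
  exact (snd_lt_card (h.isFlag.mem _)).trans_le (h.card_le hn)

theorem IsMove.mem_freeCols (h : IsMove P x I Q) (hn : P.shape.card < n) :
    x.2 ∈ freeCols P n := by
  rw [freeCols, mem_filter, mem_range]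
  exact ⟨(snd_lt_card (h.isFlag.mem 0)).trans_le (h.card_le hn), h.free⟩

theorem IsMove.freeCols_eq (h : IsMove P x I Q) (hn : P.shape.card < n) :
    freeCols Q n = insert (lastBox x P.box I).2 ((freeCols P n).erase x.2) := by
  ext c
  have hl := h.lastBox_lt hn
  rw [freeCols, mem_filter, h.free_iff, mem_insert, mem_erase, freeCols, mem_filter, mem_range]
  constructor
  · tauto
  · rintro (rfl | h')
    · exact ⟨hl, Or.inl rfl⟩
    · tauto

theorem lastBox_notMem (P : FixedPoint k) (x : ℕ × ℕ) (I : Finset (Fin k)) (n : ℕ) :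
    (lastBox x P.box I).2 ∉ (freeCols P n).erase x.2 := by
  intro hm
  rw [mem_erase, freeCols, mem_filter] at hm
  rw [lastBox] at hm
  split_ifs at hm with hI
  · exact hm.2.2 _ rfl
  · exact hm.1 rfl

theorem IsMove.mem_lam (h : IsMove P x I Q) (hn : P.shape.card < n) : x.1 ∈ lam P (n - k) :=
  (PFH.mem_lam hn.le).2 ⟨x.2, h.mem_freeCols hn, addable_colLen h.mem⟩

theorem IsMove.lam_perm (h : IsMove P x I Q) (hn : P.shape.card < n) :
    (lam Q (n - k)).Perm (muTilde (lam P (n - k)) (gam P) x.1 I) := by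
  refine List.Perm.trans ?_ (muTilde_perm _ _ _ _).symm
  rw [← Multiset.coe_eq_coe, coe_lam (h.card_le hn), h.freeCols_eq hn,
    insert_val_of_notMem (lastBox_notMem P x I n), Multiset.map_cons, ← Multiset.cons_coe,
    ← Multiset.coe_erase, coe_lam hn.le, h.colLen_lastBox, fst_lastBox, ← addable_colLen h.mem,
    ← Multiset.map_erase_of_mem _ _ (h.mem_freeCols hn), erase_val]
  congr 1
  refine Multiset.map_congr rfl fun c hc => ?_
  rw [h.shape, colLen_addBox_of_ne h.mem]
  rw [← erase_val, mem_val] at hc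
  exact ne_of_mem_erase hc

theorem IsMove.isMaximal (h : IsMove P x I Q) : IsMaximal (gam P) x.1 I := by
  rw [IsMaximal, ← gam_eq_etaOf h.box]
  refine ⟨fun s hs j hj e => ?_, fun j hj e => ?_⟩
  · simp only [gap, mem_filter, mem_univ, true_and] at hj
    have hjI : j ∉ I := fun hjI => lt_irrefl _ (hj.2 j hjI hj.1)
    have h1 := Q.isFlag.snd_lt_of_lt hj.1 e
    obtain ⟨a, ha, haj⟩ := lastBox_eq_consBox x P.box {i ∈ I | i < s}
    have hQs : Q.box s = consBox x P.box a := by rw [h.box, movedBoxes_apply, if_pos hs, ha]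
    have hQj : Q.box j = consBox x P.box j.succ := by
      rw [h.box, movedBoxes_apply, if_neg hjI]
      rfl
    have h2 := h.isFlag.snd_lt_of_lt (haj j fun i hi => by
      rw [mem_filter] at hi
      exact hj.2 i hi.1 hi.2) (by rw [← hQs, ← hQj]; exact e.symm)
    rw [← hQs, ← hQj] at h2
    omega
  · simp only [tailGap, mem_filter, mem_univ, true_and] at hj
    have hjI : j ∉ I := fun hjI => lt_irrefl _ (hj j hjI)
    obtain ⟨a, ha, haj⟩ := lastBox_eq_consBox x P.box I
    have hQj : Q.box j = consBox x P.box j.succ := by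
      rw [h.box, movedBoxes_apply, if_neg hjI]
      rfl
    rw [← fst_lastBox, gam] at e
    have h2 := h.isFlag.snd_lt_of_lt (haj j hj) (by rw [← ha, ← hQj]; exact e.symm)
    have h1 := Q.isFlag.lt_snd_of_free (i := j) h.lastBox_free (by rw [h.colLen_lastBox]; omega)
    rw [← ha, ← hQj] at h2
    omega

theorem IsMove.isPieriDatum (h : IsMove P x I Q) (hn : P.shape.card < n) :
    IsPieriDatum (lam P (n - k)) (gam P) (lam Q (n - k)) (gam Q) x.1 I :=
  ⟨h.mem_lam hn, gam_eq_etaOf h.box, h.isMaximal, h.lam_perm hn, lam_pairwise (h.card_le hn)⟩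

end PFH

namespace PFH

variable {k : ℕ} {P Q : FixedPoint k} {x : ℕ × ℕ} {I : Finset (Fin k)} {n : ℕ}

/-! ### The factor `p'_I` -/

theorem length_muTilde {l : List ℕ} {γ : Fin k → ℕ} {L : ℕ} {I : Finset (Fin k)} (hL : L ∈ l) :
    (muTilde l γ L I).length = l.length := by
  rw [(muTilde_perm l γ L I).length_eq, List.length_cons, List.length_erase_of_mem hL]
  have := List.length_pos_of_mem hL
  omega

theorem card_lt_filter_range {c n : ℕ} (h : c ≤ n) : #{d ∈ range n | d < c} = c := by
  have : ({d ∈ range n | d < c} : Finset ℕ) = range c := by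
    ext d
    simp only [mem_filter, mem_range]
    omega
  rw [this, card_range]

theorem IsMove.star_eig_box (h : IsMove P x I Q) (hn : P.shape.card < n) (j : Fin k) :
    star (eig (muTilde (lam P (n - k)) (gam P) x.1 I ++ List.ofFn (gam Q))
      ((lam P (n - k)).length + j)) = wt (Q.box j) := by
  rw [← length_muTilde (γ := gam P) (I := I) (h.mem_lam hn), star_eig, part_append_ofFn,
    coleg_append_ofFn, ← (h.lam_perm hn).countP_eq, countP_lam (h.card_le hn)]
  congr 1
  refine Prod.ext rfl ?_
  simp only
  rw [← card_lt_filter_range (box_snd_lt (h.card_le hn) j).le,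
    card_range_eq_freeCols (h.card_le hn), add_assoc]
  congr 1
  · congr 1
    refine filter_congr fun c hc => ?_
    rw [Q.isFlag.free_lt_iff (mem_filter.1 hc).2]
    rfl
  · rw [← card_union_of_disjoint]
    · congr 1
      ext i
      rw [mem_union, mem_filter, mem_filter, mem_filter, Q.isFlag.snd_lt_iff]
      simp only [mem_univ, true_and, gam]
      rcases lt_trichotomy i j with h1 | rfl | h1 <;> omega
    · rw [disjoint_filter]
      omega

theorem eig_idxOf_replicate {S : List ℕ} {T : ℕ} (hS : T ∉ S) (N : ℕ) (η : Fin k → ℕ) :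
    part (S ++ List.replicate (N + 1) T ++ List.ofFn η)
        ((S ++ List.replicate (N + 1) T).idxOf T) = T ∧
      coleg (S ++ List.replicate (N + 1) T ++ List.ofFn η)
        ((S ++ List.replicate (N + 1) T).idxOf T) + 1 =
          (S ++ List.replicate (N + 1) T).countP (T ≤ ·) + #{i | T ≤ η i} := by
  have hidx : (S ++ List.replicate (N + 1) T).idxOf T = S.length := by
    rw [List.idxOf_append_of_notMem hS, List.replicate_succ, List.idxOf_cons_self, add_zero]
  have hpart : part (S ++ List.replicate (N + 1) T ++ List.ofFn η) S.length = T := by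
    simp [part, List.replicate_succ]
  rw [hidx]
  refine ⟨hpart, ?_⟩
  rw [coleg_eq _ (by simp), hpart, List.append_assoc, List.take_left, List.replicate_succ,
    List.cons_append]
  have hdrop : (S ++ T :: (List.replicate N T ++ List.ofFn η)).drop (S.length + 1) =
      List.replicate N T ++ List.ofFn η := by
    rw [List.drop_length_add_append]
    rfl
  have hcount : S.countP (T < ·) = S.countP (T ≤ ·) := by
    refine List.countP_congr fun a ha => ?_
    have : a ≠ T := fun e => hS (e ▸ ha)
    simp only [decide_eq_true_eq]
    omega
  rw [hdrop, List.countP_append, List.countP_append, hcount, countP_ofFn η (T ≤ ·),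
    List.countP_cons_of_pos (by simp)]
  ring

theorem IsMove.star_eig_idxOf (h : IsMove P x I Q) (hn : P.shape.card < n) :
    star (q⁻¹ * eig (muTilde (lam P (n - k)) (gam P) x.1 I ++ List.ofFn (gam Q))
      ((muTilde (lam P (n - k)) (gam P) x.1 I).idxOf (lastVal (gam P) x.1 I + 1))) =
        wt (lastBox x P.box I) := by
  have hnot : lastVal (gam P) x.1 I + 1 ∉ (((lam P (n - k)).erase x.1).filter
      fun a => a ≠ lastVal (gam P) x.1 I + 1).insertionSort (· ≤ ·) := by
    rw [List.mem_insertionSort]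
    simp
  obtain ⟨h1, h2⟩ := eig_idxOf_replicate hnot
    (((lam P (n - k)).erase x.1).count (lastVal (gam P) x.1 I + 1)) (gam Q)
  change part (muTilde _ _ _ _ ++ _) ((muTilde _ _ _ _).idxOf _) = _ at h1
  change coleg (muTilde _ _ _ _ ++ _) ((muTilde _ _ _ _).idxOf _) + 1 =
    (muTilde _ _ _ _).countP _ + _ at h2
  rw [map_mul, star_eig, h1, map_inv₀, star_q]
  have hcol : coleg (muTilde (lam P (n - k)) (gam P) x.1 I ++ List.ofFn (gam Q))
      ((muTilde (lam P (n - k)) (gam P) x.1 I).idxOf (lastVal (gam P) x.1 I + 1)) =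
        (lastBox x P.box I).2 := by
    rw [← (h.lam_perm hn).countP_eq, countP_lam (h.card_le hn)] at h2
    have h3 := card_lt_filter_range (c := (lastBox x P.box I).2 + 1) (h.lastBox_lt hn)
    rw [card_range_eq_freeCols (h.card_le hn)] at h3
    have hc := h.colLen_lastBox
    rw [fst_lastBox] at hc
    have e1 : ({c ∈ freeCols Q n | c < (lastBox x P.box I).2 + 1} : Finset ℕ) =
        {c ∈ freeCols Q n | lastVal (gam P) x.1 I + 1 ≤ Q.shape.colLen c} := by
      refine filter_congr fun c hcf => ⟨fun hlt => ?_, fun hle => ?_⟩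
      · rw [← hc]
        exact Q.shape.colLen_anti _ _ (Nat.le_of_lt_succ hlt)
      · by_contra! hlt
        obtain ⟨a, ha, -⟩ := lastBox_eq_consBox x P.box I
        have hr : (lastBox x P.box I).1 < Q.shape.colLen c := by rw [fst_lastBox]; omega
        rw [ha] at hlt hr
        obtain ⟨b, -, hb⟩ := h.isFlag.exists_of_lt (Nat.lt_of_succ_le hlt) hr
        have hfr := (h.free_iff c).1 (mem_filter.1 hcf).2
        rw [ha] at hfr
        have hb2 : (consBox x P.box b).2 = c := by rw [hb]
        rcases hfr with hfr | ⟨hfr, hfr'⟩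
        · omega
        · induction b using Fin.cases with
          | zero => exact hfr hb2.symm
          | succ b => exact hfr' b hb2
    have e2 : (univ.filter fun i => (Q.box i).2 < (lastBox x P.box I).2 + 1) =
        univ.filter fun i => lastVal (gam P) x.1 I + 1 ≤ gam Q i := by
      refine filter_congr fun i _ => ?_
      have hne := h.lastBox_free i
      have hlt := Q.isFlag.free_lt_iff (i := i) h.lastBox_free
      rw [hc] at hlt
      simp only [gam]
      omega
    rw [e1, e2] at h3
    omega
  rw [hcol, wt, wt, fst_lastBox, pow_succ]
  have := q_ne_zero
  field_simp

theorem prod_gap_mul_prod_tailGap {M : Type*} [CommMonoid M] (I : Finset (Fin k)) (f : Fin k → M) :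
    (∏ j ∈ tailGap I, f j) * ∏ s ∈ I, ∏ j ∈ gap I s, f j = ∏ j with j ∉ I, f j := by
  rw [← prod_biUnion]
  · rw [← prod_union]
    · refine prod_congr ?_ fun _ _ => rfl
      ext j
      simp only [tailGap, gap, mem_union, mem_filter, mem_univ, true_and, mem_biUnion]
      constructor
      · rintro (h | ⟨s, -, h1, h2⟩) hj
        · exact lt_irrefl _ (h j hj)
        · exact lt_irrefl _ (h2 j hj h1)
      · intro hj
        rcases ({i ∈ I | j < i} : Finset (Fin k)).eq_empty_or_nonempty with h0 | h0
        · left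
          intro i hi
          have : ¬ j < i := fun hji => by
            have : i ∈ ({i ∈ I | j < i} : Finset (Fin k)) := mem_filter.2 ⟨hi, hji⟩
            rw [h0] at this
            exact notMem_empty _ this
          exact lt_of_le_of_ne (not_lt.1 this) fun e => hj (e ▸ hi)
        · right
          obtain ⟨u, ht, htm⟩ : ∃ u ∈ ({i ∈ I | j < i} : Finset (Fin k)),
              ∀ i ∈ ({i ∈ I | j < i} : Finset (Fin k)), u ≤ i :=
            ⟨_, min'_mem _ h0, fun i hi => min'_le _ i hi⟩
          rw [mem_filter] at ht
          refine ⟨u, ht.1, ht.2, fun i hi hiu => ?_⟩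
          by_contra! hji
          have : j < i := lt_of_le_of_ne hji fun e => hj (e ▸ hi)
          exact absurd (htm i (mem_filter.2 ⟨hi, this⟩)) (not_le.2 hiu)
    · rw [disjoint_left]
      intro j hj hj'
      simp only [tailGap, gap, mem_filter, mem_univ, true_and, mem_biUnion] at hj hj'
      obtain ⟨s, hs, h1, -⟩ := hj'
      exact lt_asymm (hj s hs) h1
  · intro s hs u hu hsu
    rw [Function.onFun, disjoint_left]
    intro j hj hj'
    simp only [gap, mem_filter, mem_univ, true_and] at hj hj'
    rcases lt_or_gt_of_ne hsu with h | h
    · exact lt_asymm hj.1 (hj'.2 s hs h)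
    · exact lt_asymm hj'.1 (hj.2 u hu h)

theorem prod_consecutive {M : Type*} [CommMonoid M] {I : Finset (Fin k)} (hI : I.Nonempty)
    (f : Fin k → M) :
    ∏ p ∈ I ×ˢ I with p.1 < p.2 ∧ ∀ i ∈ I, ¬ (p.1 < i ∧ i < p.2), f p.1 =
      ∏ a ∈ I.erase (I.max' hI), f a := by
  refine prod_nbij Prod.fst (fun p hp => ?_) (fun p hp p' hp' e => ?_) (fun a ha => ?_)
    fun _ _ => rfl
  · simp only [mem_filter, mem_product] at hp
    exact mem_erase.2 ⟨(hp.2.1.trans_le (I.le_max' _ hp.1.2)).ne, hp.1.1⟩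
  · simp only [coe_filter, mem_product, Set.mem_ofPred_eq] at hp hp'
    refine Prod.ext e ?_
    rcases lt_trichotomy p.2 p'.2 with h | h | h
    · exact (hp'.2.2 _ hp.1.2 ⟨e ▸ hp.2.1, h⟩).elim
    · exact h
    · exact (hp.2.2 _ hp'.1.2 ⟨e ▸ hp'.2.1, h⟩).elim
  · rw [mem_coe, mem_erase] at ha
    have h0 : ({i ∈ I | a < i} : Finset (Fin k)).Nonempty :=
      ⟨_, mem_filter.2 ⟨I.max'_mem hI, lt_of_le_of_ne (I.le_max' _ ha.2) ha.1⟩⟩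
    obtain ⟨u, ht, htm⟩ : ∃ u ∈ ({i ∈ I | a < i} : Finset (Fin k)),
        ∀ i ∈ ({i ∈ I | a < i} : Finset (Fin k)), u ≤ i :=
      ⟨_, min'_mem _ h0, fun i hi => min'_le _ i hi⟩
    rw [mem_filter] at ht
    refine ⟨(a, u), ?_, rfl⟩
    simp only [coe_filter, mem_product, Set.mem_ofPred_eq]
    refine ⟨⟨ha.2, ht.1⟩, ht.2, fun i hi hai => ?_⟩
    exact absurd (htm i (mem_filter.2 ⟨hi, hai.1⟩)) (not_le.2 hai.2)

theorem prod_lastBox_div (x : ℕ × ℕ) (w : Fin k → ℕ × ℕ) (I : Finset (Fin k)) :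
    ∏ a ∈ I, wt (lastBox x w {l ∈ I | l < a}) / wt (w a) = wt x / wt (lastBox x w I) := by
  induction I using Finset.induction_on_max with
  | empty => simp [lastBox_empty, wt_ne_zero]
  | insert a I ha ih =>
    have haI : a ∉ I := fun h => lt_irrefl _ (ha a h)
    have hmax : ∀ i ∈ insert a I, i ≤ a := fun i hi =>
      (mem_insert.1 hi).elim (fun h => h.le) fun h => (ha i h).le
    rw [prod_insert haI, lastBox_of_max (mem_insert_self a I) hmax, filter_insert,
      if_neg (lt_irrefl _), filter_true_of_mem ha]
    rw [prod_congr rfl fun i hi => by rw [filter_insert, if_neg (ha i hi).asymm], ih]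
    have h1 := wt_ne_zero (lastBox x w I)
    have h2 := wt_ne_zero (w a)
    field_simp

theorem IsMove.box_of_consecutive (h : IsMove P x I Q) {a b : Fin k} (ha : a ∈ I) (hb : b ∈ I)
    (hab : a < b) (hc : ∀ i ∈ I, ¬ (a < i ∧ i < b)) : Q.box b = P.box a := by
  rw [h.box, movedBoxes_apply, if_pos hb]
  refine lastBox_of_max (by simp [ha, hab]) fun i hi => ?_
  rw [mem_filter] at hi
  by_contra! hai
  exact hc i hi.1 ⟨hai, hi.2⟩

theorem IsMove.star_pPrime (h : IsMove P x I Q) (hn : P.shape.card < n) :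
    star (pPrime (lam P (n - k)) (gam P) x.1 I) * (wt x / wt (lastBox x P.box I)) =
      ∏ i, heckeFactor x P.box I i := by
  have he := h.star_eig_box hn
  have hz := h.star_eig_idxOf hn
  rw [pPrime]
  simp only [← gam_eq_etaOf h.box]
  rw [map_mul, map_mul, map_mul, apply_dite (f := star), mul_assoc _ (star (∏ j ∈ tailGap I, _))]
  simp only [map_prod, map_div₀, map_mul (f := star) (x := t - 1), map_sub, map_one, star_t]
  simp only [map_mul (f := star) (x := t), star_t, hz, he]
  have htail : ∀ j ∈ tailGap I, (t⁻¹ * wt (lastBox x P.box I) - wt (Q.box j)) /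
      (wt (lastBox x P.box I) - wt (Q.box j)) = heckeFactor x P.box I j := by
    intro j hj
    simp only [tailGap, mem_filter, mem_univ, true_and] at hj
    have hjI : j ∉ I := fun hjI => lt_irrefl _ (hj j hjI)
    rw [heckeFactor, if_neg hjI, filter_true_of_mem hj, h.box, movedBoxes_apply, if_neg hjI]
  have hgap : ∀ s ∈ I, ∏ j ∈ gap I s, (t⁻¹ * wt (Q.box s) - wt (Q.box j)) /
      (wt (Q.box s) - wt (Q.box j)) = ∏ j ∈ gap I s, heckeFactor x P.box I j := by
    intro s hs
    refine prod_congr rfl fun j hj => ?_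
    simp only [gap, mem_filter, mem_univ, true_and] at hj
    have hjI : j ∉ I := fun hjI => lt_irrefl _ (hj.2 j hjI hj.1)
    have hfi : ({l ∈ I | l < j} : Finset (Fin k)) = {l ∈ I | l < s} := by
      ext l
      simp only [mem_filter, and_congr_right_iff]
      exact fun hl => ⟨fun h => h.trans hj.1, fun h => hj.2 l hl h⟩
    rw [heckeFactor, if_neg hjI, hfi, h.box, movedBoxes_apply, movedBoxes_apply, if_neg hjI,
      if_pos hs]
  rw [prod_congr rfl htail, prod_congr rfl hgap, prod_gap_mul_prod_tailGap]
  have hhead : ((if hI : I.Nonempty then (t⁻¹ - 1) * wt (lastBox x P.box I) /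
        (wt (lastBox x P.box I) - wt (Q.box (I.max' hI))) else 1) *
      ∏ p ∈ I ×ˢ I with p.1 < p.2 ∧ ∀ i ∈ I, ¬ (p.1 < i ∧ i < p.2),
        (t⁻¹ - 1) * wt (Q.box p.2) / (wt (Q.box p.2) - wt (Q.box p.1))) =
      ∏ a ∈ I, (t⁻¹ - 1) * wt (P.box a) / (wt (P.box a) - wt (Q.box a)) := by
    rcases I.eq_empty_or_nonempty with h0 | h0
    · simp [h0]
    · rw [dif_pos h0, ← mul_prod_erase I _ (I.max'_mem h0), ← prod_consecutive h0,
        lastBox_of_max (I.max'_mem h0) fun i hi => I.le_max' i hi]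
      congr 1
      refine prod_congr rfl fun p hp => ?_
      simp only [mem_filter, mem_product] at hp
      rw [h.box_of_consecutive hp.1.1 hp.1.2 hp.2.1 hp.2.2]
  rw [hhead, ← prod_lastBox_div, mul_right_comm, ← prod_mul_distrib,
    ← prod_filter_mul_prod_filter_not univ (· ∈ I) (heckeFactor x P.box I), filter_univ_mem]
  congr 1
  refine prod_congr rfl fun a ha => ?_
  rw [heckeFactor, if_pos ha, h.box, movedBoxes_apply, if_pos ha]
  have h2 := wt_ne_zero (P.box a)
  have h3 : wt (lastBox x P.box {l ∈ I | l < a}) - wt (P.box a) ≠ 0 :=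
    sub_ne_zero.2 fun e => lastBox_ne h.mem (by simp) (wt_injective e)
  rw [← neg_sub (wt (lastBox x P.box _)) (wt (P.box a))]
  field_simp
  ring

end PFH

namespace PFH

variable {k : ℕ} {P Q : FixedPoint k} {x : ℕ × ℕ} {I : Finset (Fin k)} {n : ℕ}

/-! ### The eigenvalue of `λ̃` -/

theorem IsMove.star_eig_lamTilde (h : IsMove P x I Q) (hn : P.shape.card < n) :
    star (eig (lamTilde (lam P (n - k)) (gam P) x.1 I ++ List.ofFn (gam P))
      ((lam P (n - k)).length - 1)) = wt x := by
  have hL := h.mem_lam hn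
  obtain ⟨D, hD⟩ : ∃ D, muTilde (lam P (n - k)) (gam P) x.1 I =
      D ++ [lastVal (gam P) x.1 I + 1] := by
    rw [muTilde, List.replicate_succ', ← List.append_assoc]
    exact ⟨_, rfl⟩
  have hp : D.Perm ((lam P (n - k)).erase x.1) := by
    have := muTilde_perm (lam P (n - k)) (gam P) x.1 I
    rw [hD] at this
    exact (List.perm_append_singleton _ D).symm.trans this |>.cons_inv
  have hlen : (lam P (n - k)).length - 1 = D.length := by
    rw [hp.length_eq, List.length_erase_of_mem hL]
  have hpart : part (D ++ [x.1] ++ List.ofFn (gam P)) D.length = x.1 := by simp [part]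
  rw [lamTilde, hD, List.dropLast_concat, hlen, star_eig, hpart, coleg_eq _ (by simp), hpart,
    List.append_assoc, List.take_left, List.drop_length_add_append]
  have hdrop : ([x.1] ++ List.ofFn (gam P)).drop 1 = List.ofFn (gam P) := rfl
  have hc : D.countP (x.1 < ·) = (lam P (n - k)).countP (x.1 < ·) := by
    rw [hp.countP_eq, (List.perm_cons_erase hL).countP_eq, List.countP_cons_of_neg (by simp)]
  rw [hdrop, hc, countP_lam hn.le, countP_ofFn (gam P) (x.1 ≤ ·)]
  congr 1
  refine Prod.ext rfl ?_
  have hx : x.2 < n := mem_range.1 (mem_filter.1 (h.mem_freeCols hn)).1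
  simp only
  rw [← card_lt_filter_range hx.le, card_range_eq_freeCols hn.le]
  have hlt : ∀ c, c < x.2 ↔ x.1 < P.shape.colLen c := fun c => by
    rw [← addable_rowLen h.mem, lt_rowLen_iff_lt_colLen]
  congr 1
  · congr 1
    exact filter_congr fun c _ => (hlt c).symm
  · congr 1
    refine filter_congr fun i _ => ?_
    rw [hlt, P.isFlag.colLen, gam]
    omega

/-! ### Arms -/

theorem arm_eq_card {n : ℕ} (hn : P.shape.card ≤ n) (r c : ℕ) :
    arm P.shape (r, c) = #{d ∈ freeCols P n | c < d ∧ r < P.shape.colLen d} +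
      #{i | c < (P.box i).2 ∧ r ≤ gam P i} := by
  have h1 : ({d ∈ range n | c < d ∧ r < P.shape.colLen d} : Finset ℕ) =
      Ico (c + 1) (P.shape.rowLen r) := by
    ext d
    rw [mem_filter, mem_range, mem_Ico, ← lt_rowLen_iff_lt_colLen]
    have := (rowLen_le_card P.shape r).trans hn
    omega
  have h2 := card_range_eq_freeCols hn fun d => c < d ∧ r < P.shape.colLen d
  rw [h1, Nat.card_Ico] at h2
  rw [arm, h2]
  congr 2
  refine filter_congr fun i _ => ?_
  rw [P.isFlag.colLen, Nat.lt_succ_iff]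
  rfl

theorem part_reverse_lam (P : FixedPoint k) {m j : ℕ} (hj : j < m) :
    part ((lam P m).reverse ++ List.ofFn (gam P)) (m - 1 - j) = P.shape.colLen (freeCol P j) := by
  rw [part_append_of_lt _ (by rw [List.length_reverse, length_lam]; omega), ← part_lam P hj, part,
    part, List.getD_eq_getElem?_getD, List.getElem?_reverse (by rw [length_lam]; omega), length_lam,
    List.getD_eq_getElem?_getD, show m - 1 - (m - 1 - j) = j by omega]

theorem countP_drop_lam (hn : P.shape.card ≤ n) (p : ℕ → Prop) [DecidablePred p] {j : ℕ} :
    ((lam P (n - k)).drop (j + 1)).countP p =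
      #{c ∈ freeCols P n | freeCol P j < c ∧ p (P.shape.colLen c)} := by
  rw [← card_Ioo_part, length_lam]
  refine card_nbij (freeCol P) (fun r hr => ?_)
    (fun a _ b _ hab => (freeCol_strictMono P).injective hab) fun c hc => ?_
  · simp only [coe_filter, mem_Ioo, Set.mem_ofPred_eq] at hr ⊢
    exact ⟨(freeCol_mem hn).2 hr.1.2, freeCol_strictMono P hr.1.1, by
      rw [← part_lam P hr.1.2]; exact hr.2⟩
  · simp only [coe_filter, Set.mem_ofPred_eq] at hc
    obtain ⟨r, rfl⟩ := exists_freeCol (mem_filter.1 hc.1).2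
    have hr := (freeCol_mem hn).1 hc.1
    refine ⟨r, ?_, rfl⟩
    simp only [coe_filter, mem_Ioo, Set.mem_ofPred_eq]
    exact ⟨⟨(freeCol_strictMono P).lt_iff_lt.1 hc.2.1, hr⟩, by rw [part_lam P hr]; exact hc.2.2⟩

theorem card_range_reverse_lam (hn : P.shape.card ≤ n) (p : ℕ → Prop) [DecidablePred p] {j : ℕ}
    (hj : j < n - k) :
    #{r ∈ range (n - k - 1 - j) | p (part ((lam P (n - k)).reverse ++ List.ofFn (gam P)) r)} =
      #{c ∈ freeCols P n | freeCol P j < c ∧ p (P.shape.colLen c)} := by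
  rw [card_range_part _ _ (by simp [length_lam]; omega), ← countP_drop_lam hn,
    List.take_append_of_le_length (by simp [length_lam]; omega), List.take_reverse, length_lam,
    List.countP_reverse, show n - k - (n - k - 1 - j) = j + 1 by omega]

theorem card_Ioo_reverse_lam (p : ℕ → Prop) [DecidablePred p] {m j : ℕ}
    (hj : j < m) (hp : ∀ r < j, ¬ p (P.shape.colLen (freeCol P r))) :
    #{r ∈ Ioo (m - 1 - j) ((lam P m).reverse ++ List.ofFn (gam P)).length |
        p (part ((lam P m).reverse ++ List.ofFn (gam P)) r)} = #{i | p (gam P i)} := by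
  rw [card_Ioo_part, List.drop_append_of_le_length (by simp [length_lam]; omega),
    List.countP_append, countP_ofFn, List.drop_reverse, List.countP_reverse, length_lam,
    show m - (m - 1 - j + 1) = j by omega, Nat.add_eq_right, List.countP_eq_zero]
  intro a ha
  obtain ⟨r, hr, rfl⟩ := List.mem_iff_getElem.1 ha
  rw [List.length_take, length_lam] at hr
  have := hp r (by omega)
  simpa [lam, freeCol] using this

theorem armC_reverse_lam (hn : P.shape.card ≤ n) {j r : ℕ} (hj : j < n - k) :
    armC ((lam P (n - k)).reverse ++ List.ofFn (gam P)) (n - k - 1 - j) (r + 1) =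
      arm P.shape (r, freeCol P j) := by
  rw [armC, part_reverse_lam P hj, arm_eq_card hn,
    card_range_reverse_lam hn (fun a => r + 1 ≤ a ∧ a ≤ P.shape.colLen (freeCol P j)) hj,
    card_Ioo_reverse_lam (fun a => r + 1 ≤ a + 1 ∧ a < P.shape.colLen (freeCol P j)) hj]
  · congr 2
    · refine filter_congr fun c _ => ?_
      have := P.shape.colLen_anti (freeCol P j) c
      omega
    · refine filter_congr fun i _ => ?_
      have h1 := P.isFlag.free_lt_iff (i := i) (freeCol_free P j)
      rw [gam]
      omega
  · intro s hs
    have := P.shape.colLen_anti _ _ (freeCol_strictMono P hs).le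
    omega

theorem armT_reverse_lam (hn : P.shape.card ≤ n) {j r : ℕ} (hj : j < n - k)
    (hr : r < P.shape.colLen (freeCol P j)) :
    armT ((lam P (n - k)).reverse ++ List.ofFn (gam P)) (n - k - 1 - j) (r + 1) +
      #{i | gam P i = r} = arm P.shape (r, freeCol P j) := by
  rw [armT, part_reverse_lam P hj, arm_eq_card hn,
    card_range_reverse_lam hn (fun a => r + 1 ≤ a ∧ a ≤ P.shape.colLen (freeCol P j)) hj,
    card_Ioo_reverse_lam (fun a => r + 1 ≤ a ∧ a < P.shape.colLen (freeCol P j)) hj, add_assoc]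
  · congr 1
    · congr 1
      refine filter_congr fun c _ => ?_
      have := P.shape.colLen_anti (freeCol P j) c
      omega
    · rw [← card_union_of_disjoint]
      · congr 1
        ext i
        rw [mem_union, mem_filter, mem_filter, mem_filter]
        have h1 := P.isFlag.free_lt_iff (i := i) (freeCol_free P j)
        simp only [mem_univ, true_and, gam]
        omega
      · rw [disjoint_filter]
        omega
  · intro s hs
    have := P.shape.colLen_anti _ _ (freeCol_strictMono P hs).le
    omega

/-! ### The row and column factors -/

theorem prod_freeCol {M : Type*} [CommMonoid M] (hn : P.shape.card ≤ n) (f : ℕ → M) :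
    ∏ j ∈ range (n - k), f (freeCol P j) = ∏ c ∈ freeCols P n, f c := by
  refine prod_nbij (freeCol P) (fun j hj => (freeCol_mem hn).2 (mem_range.1 hj))
    (fun a _ b _ hab => (freeCol_strictMono P).injective hab) (fun c hc => ?_) fun _ _ => rfl
  obtain ⟨r, rfl⟩ := exists_freeCol (mem_filter.1 hc).2
  exact ⟨r, mem_range.2 ((freeCol_mem hn).1 hc), rfl⟩

theorem star_row_quotient (l a : ℕ) :
    star ((t - q ^ (l + 1) * t ^ (a + 1)) / (1 - q ^ (l + 1) * t ^ (a + 1))) =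
      (t ^ a - q ^ (l + 1)) / (t ^ (a + 1) - q ^ (l + 1)) := by
  have ht := t_ne_zero
  have h1 : (t ^ (a + 1))⁻¹ ≠ 0 := inv_ne_zero (pow_ne_zero _ ht)
  simp only [map_div₀, map_sub, map_mul, map_pow, map_one, star_t, star_q, inv_pow]
  rw [← mul_div_mul_left (t ^ a - q ^ (l + 1)) _ h1]
  congr 1
  · field_simp
    ring
  · field_simp

theorem star_column_quotient (l a m : ℕ) :
    star ((1 - q ^ l * t ^ (a + 1)) / (1 - q ^ (l + 1) * t ^ (a + 1 + m))) =
      t ^ m * (t ^ (a + 1) - q ^ l) / (t ^ (a + m + 1) - q ^ (l + 1)) := by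
  have ht := t_ne_zero
  have h1 : (t ^ (a + 1 + m))⁻¹ ≠ 0 := inv_ne_zero (pow_ne_zero _ ht)
  simp only [map_div₀, map_sub, map_mul, map_pow, map_one, star_t, star_q, inv_pow]
  rw [← mul_div_mul_left (t ^ m * (t ^ (a + 1) - q ^ l)) _ h1]
  congr 1
  · field_simp
    ring
  · field_simp
    ring

/-- The factor of `d_{μ+x,μ}` for a box in the row of `x`. -/
noncomputable def rowTerm (μ : YoungDiagram) (b : ℕ × ℕ) : K :=
  (t ^ arm μ b - q ^ (leg μ b + 1)) / (t ^ (arm μ b + 1) - q ^ (leg μ b + 1))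

theorem star_rowFactor (hn : P.shape.card ≤ n) (L : ℕ) :
    star (rowFactor (lam P (n - k)) (gam P) L) =
      ∏ c ∈ freeCols P n, if L < P.shape.colLen c then rowTerm P.shape (L, c) else 1 := by
  rw [rowFactor, map_prod, prod_filter, length_lam, ← prod_range_reflect, ← prod_freeCol hn]
  refine prod_congr rfl fun j hj => ?_
  rw [mem_range] at hj
  rw [part_reverse_lam P hj]
  refine if_ctx_congr Nat.succ_le_iff (fun _ => ?_) fun _ => rfl
  rw [armC_reverse_lam hn hj, star_row_quotient, legC, part_reverse_lam P hj]
  rfl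

theorem star_jC (hn : P.shape.card < n) (hx : x ∈ addable P.shape) (hf : ∀ i, (P.box i).2 ≠ x.2)
    (hxn : x.2 < n) :
    star (jC (lam P (n - k)) (gam P) x.1) = ∏ r ∈ range x.1,
      t ^ #{i | gam P i = r} *
        (t ^ (arm P.shape (r, x.2) - #{i | gam P i = r} + 1) - q ^ (x.1 - (r + 1))) /
        (t ^ (arm P.shape (r, x.2) + 1) - q ^ (x.1 - (r + 1) + 1)) := by
  obtain ⟨j, hj⟩ := exists_freeCol hf
  have hjm : j < n - k := (freeCol_mem hn.le).1 (by
    rw [hj, freeCols, mem_filter, mem_range]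
    exact ⟨hxn, hf⟩)
  have hcol : P.shape.colLen (freeCol P j) = x.1 := by rw [hj, addable_colLen hx]
  have hsup : ({i ∈ range (lam P (n - k)).length |
      part ((lam P (n - k)).reverse ++ List.ofFn (gam P)) i = x.1} : Finset ℕ).sup id =
        n - k - 1 - j := by
    rw [length_lam]
    apply le_antisymm
    · refine Finset.sup_le fun i hi => ?_
      rw [mem_filter, mem_range] at hi
      have h1 := part_reverse_lam P (m := n - k) (j := n - k - 1 - i) (by omega)
      rw [show n - k - 1 - (n - k - 1 - i) = i by omega, hi.2] at h1
      have h2 : ¬ freeCol P (n - k - 1 - i) < x.2 := by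
        rw [← addable_rowLen hx, lt_rowLen_iff_lt_colLen]
        omega
      rw [← hj, (freeCol_strictMono P).lt_iff_lt] at h2
      simp only [id]
      omega
    · refine Finset.le_sup (f := id) (b := n - k - 1 - j) ?_
      rw [mem_filter, mem_range, part_reverse_lam P hjm]
      exact ⟨by omega, hcol⟩
  rw [jC]
  simp only [hsup]
  rw [map_prod]
  refine (prod_nbij (· + 1) (fun r hr => ?_) (fun a _ b _ hab => Nat.succ_injective hab)
    (fun s hs => ?_) fun r hr => ?_).symm
  · rw [mem_range] at hr
    rw [mem_Icc]
    omega
  · rw [mem_coe, mem_Icc] at hs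
    exact ⟨s - 1, by rw [mem_coe, mem_range]; omega, by simp only; omega⟩
  · rw [mem_range] at hr
    have harm := armT_reverse_lam hn.le hjm (r := r) (by omega)
    rw [hj] at harm
    simp only [legC, part_reverse_lam P hjm, hcol, Nat.add_sub_cancel]
    rw [star_column_quotient, ← harm, Nat.add_sub_cancel]

theorem eq_Ico_of_upper {S : Finset ℕ} {R : ℕ} (h1 : ∀ c ∈ S, c < R)
    (h2 : ∀ c ∈ S, ∀ d < R, c < d → d ∈ S) : S = Ico (R - #S) R := by
  rcases S.eq_empty_or_nonempty with rfl | hS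
  · simp
  · have hmem := S.min'_mem hS
    have hmin := fun c hc => S.min'_le c hc
    have hS' : S = Ico (S.min' hS) R := by
      ext c
      rw [mem_Ico]
      constructor
      · exact fun hc => ⟨hmin c hc, h1 c hc⟩
      · rintro ⟨h3, h4⟩
        rcases h3.lt_or_eq with h5 | h5
        · exact h2 _ hmem c h4 h5
        · rwa [← h5]
    have hlt := h1 _ hmem
    generalize S.min' hS = a at *
    rw [hS', Nat.card_Ico]
    congr 1
    omega

theorem prod_Ico_quotient {f : ℕ → K} {a b : ℕ} (hab : a ≤ b) (hf : ∀ i, a ≤ i → f (i + 1) ≠ 0) :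
    (∏ i ∈ Ico a b, f i / f (i + 1)) * f b = f a := by
  induction b, hab using Nat.le_induction with
  | base => simp
  | succ b hb ih =>
    rw [prod_Ico_succ_top hb, mul_assoc, div_mul_cancel₀ _ (hf b hb), ih]

/-- The factor of `t^k d_+` for the labeled box `w`. -/
noncomputable def labelTerm (x w : ℕ × ℕ) : K :=
  t * ((wt x - q * wt w) / (wt x - q * t * wt w))

theorem labelTerm_of_le {x w : ℕ × ℕ} (hr : w.1 < x.1) (hc : x.2 ≤ w.2) :
    labelTerm x w = t * ((t ^ (w.2 - x.2) - q ^ (x.1 - (w.1 + 1))) /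
      (t ^ (w.2 - x.2 + 1) - q ^ (x.1 - (w.1 + 1)))) := by
  obtain ⟨a, ha⟩ : ∃ a, x.1 = w.1 + 1 + a := Nat.exists_eq_add_of_le (Nat.succ_le_of_lt hr)
  obtain ⟨b, hb⟩ := Nat.exists_eq_add_of_le hc
  have h1 : -(q ^ (w.1 + 1) * t ^ x.2) ≠ 0 :=
    neg_ne_zero.2 (mul_ne_zero (pow_ne_zero _ q_ne_zero) (pow_ne_zero _ t_ne_zero))
  rw [labelTerm, ← mul_div_mul_left (t ^ (w.2 - x.2) - _) _ h1, wt, wt,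
    show x.1 - (w.1 + 1) = a by omega, show w.2 - x.2 = b by omega, hb, ha]
  congr 2 <;> ring

theorem labelTerm_mul_rowTerm (hx : x ∈ addable P.shape) (i : Fin k)
    (h : x.1 ≤ (P.box i).1) :
    labelTerm x (P.box i) * rowTerm P.shape (x.1, (P.box i).2) = 1 := by
  have hlt : (P.box i).2 < x.2 := by
    rw [← addable_rowLen hx, lt_rowLen_iff_lt_colLen, P.isFlag.colLen]
    omega
  obtain ⟨a, ha⟩ : ∃ a, x.2 = (P.box i).2 + 1 + a :=
    Nat.exists_eq_add_of_le (Nat.succ_le_of_lt hlt)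
  obtain ⟨e, he⟩ := Nat.exists_eq_add_of_le h
  have harm : arm P.shape (x.1, (P.box i).2) = a := by
    rw [arm, addable_rowLen hx]
    simp only
    omega
  have hleg : leg P.shape (x.1, (P.box i).2) = e := by
    rw [leg, P.isFlag.colLen]
    simp only
    omega
  have h1 : t * (wt x - q * wt (P.box i)) =
      q ^ x.1 * t ^ ((P.box i).2 + 1) * (t ^ (a + 1) - q ^ (e + 1)) := by
    rw [wt, wt, ha, he]
    ring
  have h2 : wt x - q * t * wt (P.box i) =
      q ^ x.1 * t ^ ((P.box i).2 + 1) * (t ^ a - q ^ (e + 1)) := by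
    rw [wt, wt, ha, he]
    ring
  have hq := pow_ne_zero x.1 q_ne_zero
  have ht := pow_ne_zero ((P.box i).2 + 1) t_ne_zero
  have h3 : t ^ (a + 1) - q ^ (e + 1) ≠ 0 := t_pow_sub_q_pow_ne_zero (Or.inl (by omega))
  have h4 : t ^ a - q ^ (e + 1) ≠ 0 := t_pow_sub_q_pow_ne_zero (Or.inr (by omega))
  rw [labelTerm, ← mul_div_assoc, h1, h2, rowTerm, harm, hleg]
  field_simp

theorem prod_labelTerm_row (hx : x ∈ addable P.shape) (hf : ∀ i, (P.box i).2 ≠ x.2) {r : ℕ}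
    (hr : r < x.1) :
    (∏ i with gam P i = r, labelTerm x (P.box i)) *
        (t ^ (arm P.shape (r, x.2) + 1) - q ^ (x.1 - (r + 1))) =
      t ^ #{i | gam P i = r} *
        (t ^ (arm P.shape (r, x.2) - #{i | gam P i = r} + 1) - q ^ (x.1 - (r + 1))) := by
  have hcol : ∀ i, gam P i = r → x.2 < (P.box i).2 := fun i hi => by
    by_contra! hle
    have h1 := lt_of_le_of_ne hle (hf i)
    rw [← addable_rowLen hx, lt_rowLen_iff_lt_colLen, P.isFlag.colLen] at h1
    rw [gam] at hi
    omega
  have hrow : ∀ i, gam P i = r → (P.box i).2 < P.shape.rowLen r := fun i hi => by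
    rw [lt_rowLen_iff_lt_colLen, P.isFlag.colLen]
    rw [gam] at hi
    omega
  set S : Finset ℕ := ({i | gam P i = r} : Finset (Fin k)).image fun i => (P.box i).2 - x.2 with hS
  have hinj : Set.InjOn (fun i => (P.box i).2 - x.2) ({i | gam P i = r} : Finset (Fin k)) := by
    intro i hi j hj hij
    rw [mem_coe, mem_filter] at hi hj
    have h1 := hcol i hi.2
    have h2 := hcol j hj.2
    simp only at hij
    exact P.isFlag.col_injective (show (P.box i).2 = (P.box j).2 by omega)
  have hcard : #S = #{i | gam P i = r} := card_image_of_injOn hinj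
  have hxr : x.2 < P.shape.rowLen r := by
    rw [lt_rowLen_iff_lt_colLen, addable_colLen hx]
    exact hr
  have harm : arm P.shape (r, x.2) + 1 = P.shape.rowLen r - x.2 := by
    rw [arm]
    simp only
    omega
  have hIco : S = Ico (P.shape.rowLen r - x.2 - #S) (P.shape.rowLen r - x.2) := by
    refine eq_Ico_of_upper (fun c hc => ?_) fun c hc d hd hcd => ?_
    · rw [hS, mem_image] at hc
      obtain ⟨i, hi, rfl⟩ := hc
      have h1 := hcol i (mem_filter.1 hi).2
      have h2 := hrow i (mem_filter.1 hi).2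
      omega
    · rw [hS, mem_image] at hc ⊢
      obtain ⟨i, hi, rfl⟩ := hc
      have h1 := hcol i (mem_filter.1 hi).2
      have hir := (mem_filter.1 hi).2
      rw [gam] at hir
      have h3 : r < P.shape.colLen (d + x.2) := by
        rw [← lt_rowLen_iff_lt_colLen]
        omega
      obtain ⟨j, -, hj⟩ := P.isFlag.exists_of_lt (i := i) (c := d + x.2) (by omega) (by omega)
      refine ⟨j, mem_filter.2 ⟨mem_univ _, ?_⟩, ?_⟩
      · rw [gam, hj]
        exact hir
      · rw [hj]
        simp
  have hle : #S ≤ arm P.shape (r, x.2) := by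
    rcases S.eq_empty_or_nonempty with h0 | ⟨c, hc⟩
    · simp [h0]
    · have h0 : 0 ∉ S := by
        rw [hS, mem_image]
        rintro ⟨i, hi, h1⟩
        have := hcol i (mem_filter.1 hi).2
        omega
      by_contra! hlt
      rw [hIco, mem_Ico] at h0
      omega
  rw [prod_congr rfl fun i hi => by
    rw [labelTerm_of_le (by have := (mem_filter.1 hi).2; rw [gam] at this; omega)
      (hcol i (mem_filter.1 hi).2).le, show (P.box i).1 = r from (mem_filter.1 hi).2]]
  rw [prod_mul_distrib, prod_const, mul_assoc]
  congr 1
  rw [← prod_image (f := fun d => (t ^ d - q ^ (x.1 - (r + 1))) / (t ^ (d + 1) - q ^ (x.1 - (r + 1))))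
    hinj, ← hS, ← hcard, harm]
  have hstart : arm P.shape (r, x.2) - #S + 1 = P.shape.rowLen r - x.2 - #S := by omega
  rw [hstart]
  conv_lhs => rw [hIco]
  exact prod_Ico_quotient (f := fun d => t ^ d - q ^ (x.1 - (r + 1))) (Nat.sub_le _ _)
    fun i _ => t_pow_sub_q_pow_ne_zero (Or.inl (by omega))

theorem prod_cells_row (μ : YoungDiagram) (f : ℕ × ℕ → K) {r n : ℕ} (hn : μ.card ≤ n) :
    ∏ b ∈ μ.cells with b.1 = r, f b = ∏ c ∈ range n, if r < μ.colLen c then f (r, c) else 1 := by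
  rw [← prod_filter]
  refine (prod_nbij (fun c => (r, c)) (fun c hc => ?_) (fun a _ b _ hab => by simpa using hab)
    (fun b hb => ?_) fun _ _ => rfl).symm
  · rw [mem_filter] at hc ⊢
    exact ⟨YoungDiagram.mem_iff_lt_colLen.2 hc.2, rfl⟩
  · rw [mem_coe, mem_filter] at hb
    obtain ⟨hb, rfl⟩ := hb
    refine ⟨b.2, ?_, rfl⟩
    rw [mem_coe, mem_filter, mem_range]
    exact ⟨(snd_lt_card hb).trans_le hn, YoungDiagram.mem_iff_lt_colLen.1 hb⟩

theorem prod_cells_column (μ : YoungDiagram) (f : ℕ × ℕ → K) (c : ℕ) :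
    ∏ b ∈ μ.cells with b.2 = c, f b = ∏ r ∈ range (μ.colLen c), f (r, c) := by
  refine (prod_nbij (fun r => (r, c)) (fun r hr => ?_) (fun a _ b _ hab => by simpa using hab)
    (fun b hb => ?_) fun _ _ => rfl).symm
  · rw [mem_filter]
    exact ⟨YoungDiagram.mem_iff_lt_colLen.2 (mem_range.1 hr), rfl⟩
  · rw [mem_coe, mem_filter] at hb
    obtain ⟨hb, rfl⟩ := hb
    exact ⟨b.1, mem_range.2 (YoungDiagram.mem_iff_lt_colLen.1 hb), rfl⟩

theorem macPieri_eq_star (hn : P.shape.card < n) (hx : x ∈ addable P.shape)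
    (hf : ∀ i, (P.box i).2 ≠ x.2) (hxn : x.2 < n) :
    t ^ k * macPieri P.shape x *
        ∏ i, (wt x - q * wt (P.box i)) / (wt x - q * t * wt (P.box i)) =
      star (rowFactor (lam P (n - k)) (gam P) x.1 * jC (lam P (n - k)) (gam P) x.1) := by
  have hlab : t ^ k * ∏ i, (wt x - q * wt (P.box i)) / (wt x - q * t * wt (P.box i)) =
      ∏ i, labelTerm x (P.box i) := by
    simp only [labelTerm, prod_mul_distrib, prod_const, card_univ, Fintype.card_fin]
  have hcancel : (∏ i, labelTerm x (P.box i)) *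
      (∏ i, if x.1 < P.shape.colLen (P.box i).2 then rowTerm P.shape (x.1, (P.box i).2) else 1) =
        ∏ r ∈ range x.1, ∏ i with gam P i = r, labelTerm x (P.box i) := by
    rw [← prod_mul_distrib]
    have h1 : ∏ i, (labelTerm x (P.box i) *
        if x.1 < P.shape.colLen (P.box i).2 then rowTerm P.shape (x.1, (P.box i).2) else 1) =
          ∏ i with gam P i < x.1, labelTerm x (P.box i) := by
      rw [prod_filter]
      refine prod_congr rfl fun i _ => ?_
      rw [P.isFlag.colLen, gam]
      split_ifs with h2 h3 h3
      · omega
      · exact labelTerm_mul_rowTerm hx i (by omega)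
      · rw [mul_one]
      · omega
    rw [h1, ← prod_fiberwise_of_maps_to (g := gam P) (t := range x.1)
      fun i hi => mem_range.2 (mem_filter.1 hi).2]
    refine prod_congr rfl fun r hr => prod_congr ?_ fun _ _ => rfl
    rw [filter_filter]
    refine filter_congr fun i _ => ?_
    rw [mem_range] at hr
    omega
  have hrow : (∏ b ∈ P.shape.cells with b.1 = x.1, (t ^ arm P.shape b - q ^ (leg P.shape b + 1)) /
      (t ^ (arm P.shape b + 1) - q ^ (leg P.shape b + 1))) =
        star (rowFactor (lam P (n - k)) (gam P) x.1) *
          ∏ i, if x.1 < P.shape.colLen (P.box i).2 then rowTerm P.shape (x.1, (P.box i).2) else 1 := by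
    rw [star_rowFactor hn.le, ← prod_range_eq_freeCols hn.le fun c =>
      if x.1 < P.shape.colLen c then rowTerm P.shape (x.1, c) else 1]
    exact prod_cells_row P.shape (rowTerm P.shape) hn.le
  rw [macPieri, hrow, map_mul, star_jC hn hx hf hxn]
  rw [prod_cells_column P.shape (fun b => (t ^ (arm P.shape b + 1) - q ^ leg P.shape b) /
    (t ^ (arm P.shape b + 1) - q ^ (leg P.shape b + 1))), addable_colLen hx]
  have hprod : (∏ r ∈ range x.1, ∏ i with gam P i = r, labelTerm x (P.box i)) *
      ∏ r ∈ range x.1, (t ^ (arm P.shape (r, x.2) + 1) - q ^ leg P.shape (r, x.2)) /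
        (t ^ (arm P.shape (r, x.2) + 1) - q ^ (leg P.shape (r, x.2) + 1)) =
      ∏ r ∈ range x.1, t ^ #{i | gam P i = r} *
        (t ^ (arm P.shape (r, x.2) - #{i | gam P i = r} + 1) - q ^ (x.1 - (r + 1))) /
        (t ^ (arm P.shape (r, x.2) + 1) - q ^ (x.1 - (r + 1) + 1)) := by
    rw [← prod_mul_distrib]
    refine prod_congr rfl fun r hr => ?_
    have hleg : leg P.shape (r, x.2) = x.1 - (r + 1) := by rw [leg, addable_colLen hx]
    rw [hleg, ← mul_div_assoc, prod_labelTerm_row hx hf (mem_range.1 hr)]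
  rw [← hprod, ← hcancel, ← hlab]
  ring

/-! ### The comparison of coefficients -/

theorem IsMove.movedCoeff_eq (h : IsMove P x I Q) (hn : P.shape.card < n) :
    movedCoeff P x I = t ^ (-((lastBox x P.box I).2 : ℤ)) *
      star (pieriCoeff (lam P (n - k)) (gam P) (lam Q (n - k)) (gam Q) * (1 - t)) := by
  have hxn : x.2 < n := mem_range.1 (mem_filter.1 (h.mem_freeCols hn)).1
  rw [pieriCoeff_eq (h.isPieriDatum hn), movedCoeff, macPieri_eq_star hn h.mem h.free hxn,
    ← h.star_pPrime hn, pieriTerm]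
  have ht1 : (1 - t : K) ≠ 0 := by
    have := t_pow_sub_q_pow_ne_zero (a := 1) (b := 0) (Or.inl one_ne_zero)
    intro e
    apply this
    linear_combination -e
  have hassoc : ∀ a b c d e : K, a * b * c * (1 / (1 - t)) * d * e * (1 - t) =
      a * b * c * d * e := fun a b c d e => by field_simp
  simp only [hassoc, map_mul, h.star_eig_lamTilde hn]
  have hq : star (q ^ (-((lastVal (gam P) x.1 I + 1 : ℕ) : ℤ) + 1)) =
      (q ^ (lastBox x P.box I).1)⁻¹ := by
    rw [map_zpow₀, star_q, fst_lastBox]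
    push_cast
    rw [neg_add_rev, neg_add_cancel_comm, zpow_neg, zpow_natCast]
  have hw : wt (lastBox x P.box I) =
      q ^ (lastBox x P.box I).1 * t ^ (lastBox x P.box I).2 := rfl
  rw [hq, zpow_neg, zpow_natCast, hw, div_eq_mul_inv, mul_inv]
  ring

end PFH

theorem theorem6p4 {k : ℕ} (P : PFH.FixedPoint k) (n : ℕ) (hn : P.shape.card < n) :
    PFH.eOne k (PFH.H k P) =
        ∑ x ∈ PFH.addable P.shape, ∑ I : Finset (Fin k),
          ∑ᶠ h : PFH.IsFlag (PFH.addBox P.shape x) (PFH.movedBoxes x P.box I),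
            PFH.geomCoeff P ⟨_, _, h⟩ • PFH.H k ⟨_, _, h⟩ ∧
      ∀ x ∈ PFH.addable P.shape, ∀ I : Finset (Fin k), ∀ Q : PFH.FixedPoint k,
        Q.shape = PFH.addBox P.shape x → Q.box = PFH.movedBoxes x P.box I →
          PFH.geomCoeff P Q =
            PFH.t ^ (-((PFH.lastBox x P.box I).2 : ℤ)) *
              PFH.star
                (PFH.pieriCoeff (PFH.lam P (n - k)) (PFH.gam P) (PFH.lam Q (n - k)) (PFH.gam Q) *
                  (1 - PFH.t)) := by
  refine ⟨PFH.eOne_H_eq_sum P, fun x hx I Q h1 h2 => ?_⟩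
  rw [PFH.geomCoeff_eq P Q hx I h1 h2]
  by_cases hf : ∀ i, (P.box i).2 ≠ x.2
  · exact PFH.IsMove.movedCoeff_eq ⟨hx, h1, h2, hf⟩ hn
  · push Not at hf
    obtain ⟨a, ha⟩ := hf
    rw [PFH.pieriCoeff_of_not_free hn hx h1 h2 ha, PFH.movedCoeff,
      PFH.prod_quotient_eq_zero hx ha]
    simp
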